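/- Let $N\ge 1$, $0<s<1$, $1<p<\infty$, $p'=p/(p-1)$, and let $\Omega\subset\mathbb R^N$ be bounded and open. Let $W^{s,p}(\mathbb R^N)$ carry the norm $\|f\|_{L^p(\mathbb R^N)}+[f]$, where $[f]^p=\iint_{\mathbb R^N\times\mathbb R^N}\frac{|f(x)-f(y)|^p}{|x-y|^{N+sp}}\,dx\,dy$, and let $W^{s,p}_0(\Omega)$ be the subspace of those $f\in W^{s,p}(\mathbb R^N)$ that vanish a.e. outside $\Omega$. Assume that $C_c^\infty(\Omega)$ is dense in $W^{s,p}_0(\Omega)$. Put $\Omega_T=\Omega\times(0,T)$ and $$H(x,y,\xi)=\frac1p\left(\frac{|\xi|}{|x-y|^s}\right)^p .$$ Let $u_0\in W^{s,p}(\mathbb R^N)$ with $u_0|_\Omega\in L^2(\Omega)$, and let $0<T_{\max}\le\infty$. *Weak solution.* $u$ is a weak solution up to $T_{\max}$ of $$\partial_t u+\mathrm{P.V.}\int_{\mathbb R^N}\frac{D_\xi H(x,y,u(x,t)-u(y,t))}{|x-y|^N}\,dy=0\ \text{ in }\Omega,\qquad u=u_0\ \text{ outside }\Omega,$$ if for every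 finite $T$ with $0<T\le T_{\max}$: $u\in L^p(0,T;W^{s,p}(\mathbb R^N))\cap C([0,T];L^2(\Omega))$, $u-u_0\in L^p(0,T;W^{s,p}_0(\Omega))$, the distributional derivative $\partial_t u$ on $\Omega_T$ is given by an element of $L^{p'}(0,T;W^{s,p}_0(\Omega)^*)$, and for all $\tau\in(0,T]$ and $\varphi\in C_c^\infty(\Omega_\tau)$ $$\int_0^\tau\!\!\iint_{\mathbb R^N\times\mathbb R^N}\frac{D_\xi H(x,y,u(x,t)-u(y,t))\,(\varphi(x,t)-\varphi(y,t))}{|x-y|^N}\,dx\,dy\,dt+\int_0^\tau\langle\partial_t u,\varphi\rangle\,dt=0 .$$ *Variational solution.* $u$ is a variational solution up to $T_{\max}$ if for every finite $T$ with $0<T\le T_{\max}$: $u\in L^p(0,T;W^{s,p}(\mathbb R^N))\cap C([0,T];L^2(\Omega))$, $u-u_0\in L^p(0,T;W^{s,p}_0(\Omega))$, and $$\int_0^T\!\!\int_\Omega\partial_t v\,(v-u)\,dx\,dt+\int_0^T\!\!\iint_{\mathbb R^N\times\mathbb R^N}\frac{H(x,y,v(x,t)-v(y,t))-H(x,y,u(x,t)-u(y,t))}{|x-y|^N}\,dx\,dy\,dt\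 \ge\ \frac12\|(v-u)(\cdot,T)\|_{L^2(\Omega)}^2-\frac12\|(v-u)(\cdot,0)\|_{L^2(\Omega)}^2$$ for all comparison maps $v\in L^p(0,T;W^{s,p}(\mathbb R^N))\cap C([0,T];L^2(\Omega))$ with $v-u_0\in L^p(0,T;W^{s,p}_0(\Omega))$ and $\partial_t v\in L^2(\Omega_T)$. **Claim.** Let $u$ be a weak solution up to $T_{\max}$, and suppose that either $p>\frac{2N}{2s+N}$, or $\partial_t u\in L^2(\Omega_T)$ for every finite $T\in(0,T_{\max}]$. Then $u$ is a variational solution up to $T_{\max}$. If moreover $u(\cdot,0)=u_0$ a.e. in $\Omega$, then for all such $T$ and $v$ also $$\int_0^T\!\!\iint_{\mathbb R^N\times\mathbb R^N}\frac{H(x,y,u(x,t)-u(y,t))}{|x-y|^N}\,dx\,dy\,dt\le\int_0^T\!\!\iint_{\mathbb R^N\times\mathbb R^N}\frac{H(x,y,v(x,t)-v(y,t))}{|x-y|^N}\,dx\,dy\,dt+\int_0^T\!\!\int_\Omega\partial_t v\,(v-u)\,dx\,dt+\frac12\|v(\cdot,0)-u_0\|_{L^2(\Omega)}^2-\frac12\|(v-u)(\cdot,T)\|_{L^2(\Omega)}^2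 .$$ -/

import Mathlib

open MeasureTheory Set Filter Topology
open scoped ENNReal ContDiff

noncomputable section

/-- The Euclidean space of dimension `N`. -/
abbrev RN (N : ℕ) : Type := EuclideanSpace ℝ (Fin N)

instance factOneLeOfReal {p : ℝ} [hp : Fact (1 < p)] : Fact (1 ≤ ENNReal.ofReal p) :=
  ⟨ENNReal.one_le_ofReal.mpr hp.out.le⟩

section FractionalSobolev

variable {N : ℕ}

/-- The difference quotient `(f x - f y) / |x - y| ^ (N / p + s)`. Its norm in
`L^p (ℝ^N × ℝ^N)` is the Gagliardo seminorm of `f`. -/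
def diffQuot (s p : ℝ) (f : RN N → ℝ) (z : RN N × RN N) : ℝ :=
  (f z.1 - f z.2) / ‖z.1 - z.2‖ ^ ((N : ℝ) / p + s)

/-- `f` is in `W^{s,p}_0(Ω)`: it is in `L^p(ℝ^N)`, its Gagliardo seminorm over `ℝ^N × ℝ^N` is
finite, and it vanishes (almost everywhere) outside `Ω`. With `Ω = univ` this is
`W^{s,p}(ℝ^N)`. -/
structure MemW0 (Ω : Set (RN N)) (s p : ℝ) (f : RN N → ℝ) : Prop where
  memLp : MemLp f (ENNReal.ofReal p) volume
  memLp_diffQuot : MemLp (diffQuot s p f) (ENNReal.ofReal p) volume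
  vanish : ∀ᵐ x ∂(volume : Measure (RN N)), x ∉ Ω → f x = 0

theorem diffQuot_zero (s p : ℝ) : diffQuot s p (0 : RN N → ℝ) = 0 := by
  funext z; simp [diffQuot]

theorem diffQuot_add (s p : ℝ) (f g : RN N → ℝ) :
    diffQuot s p (f + g) = diffQuot s p f + diffQuot s p g := by
  funext z; simp only [diffQuot, Pi.add_apply]; ring

theorem diffQuot_smul (s p : ℝ) (c : ℝ) (f : RN N → ℝ) :
    diffQuot s p (c • f) = c • diffQuot s p f := by
  funext z; simp only [diffQuot, Pi.smul_apply, smul_eq_mul]; ring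

theorem MemW0.zero (Ω : Set (RN N)) (s p : ℝ) : MemW0 Ω s p (0 : RN N → ℝ) where
  memLp := MemLp.zero
  memLp_diffQuot := by rw [diffQuot_zero]; exact MemLp.zero
  vanish := by simp

theorem MemW0.add {Ω : Set (RN N)} {s p : ℝ} {f g : RN N → ℝ}
    (hf : MemW0 Ω s p f) (hg : MemW0 Ω s p g) : MemW0 Ω s p (f + g) where
  memLp := hf.memLp.add hg.memLp
  memLp_diffQuot := by rw [diffQuot_add]; exact hf.memLp_diffQuot.add hg.memLp_diffQuot
  vanish := by
    filter_upwards [hf.vanish, hg.vanish] with x h1 h2 hx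
    simp [h1 hx, h2 hx]

theorem MemW0.smul {Ω : Set (RN N)} {s p : ℝ} {f : RN N → ℝ} (c : ℝ)
    (hf : MemW0 Ω s p f) : MemW0 Ω s p (c • f) where
  memLp := hf.memLp.const_smul c
  memLp_diffQuot := by rw [diffQuot_smul]; exact hf.memLp_diffQuot.const_smul c
  vanish := by
    filter_upwards [hf.vanish] with x h1 hx
    simp [h1 hx]

/-- The pairs of a class `f` in `W^{s,p}_0(Ω)` and its difference quotient, as a subspace of the
`ℓ^1` sum of `L^p(ℝ^N)` and `L^p(ℝ^N × ℝ^N)`. -/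
def W0Submodule (Ω : Set (RN N)) (s p : ℝ) [Fact (1 < p)] :
    Submodule ℝ (WithLp 1 (Lp ℝ (ENNReal.ofReal p) (volume : Measure (RN N)) ×
      Lp ℝ (ENNReal.ofReal p) (volume : Measure (RN N × RN N)))) where
  carrier := {w | ∃ f : RN N → ℝ, MemW0 Ω s p f ∧ w.fst =ᵐ[volume] f ∧
    w.snd =ᵐ[volume] diffQuot s p f}
  zero_mem' := ⟨0, MemW0.zero Ω s p, Lp.coeFn_zero _ _ _, by
    rw [diffQuot_zero]; exact Lp.coeFn_zero _ _ _⟩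
  add_mem' := by
    rintro a b ⟨f, hf, hf1, hf2⟩ ⟨g, hg, hg1, hg2⟩
    refine ⟨f + g, hf.add hg, (Lp.coeFn_add _ _).trans (hf1.add hg1), ?_⟩
    rw [diffQuot_add]
    exact (Lp.coeFn_add _ _).trans (hf2.add hg2)
  smul_mem' := by
    rintro c a ⟨f, hf, hf1, hf2⟩
    refine ⟨c • f, hf.smul c, (Lp.coeFn_smul _ _).trans (hf1.const_smul c), ?_⟩
    rw [diffQuot_smul]
    exact (Lp.coeFn_smul _ _).trans (hf2.const_smul c)

/-- The normed space `W^{s,p}_0(Ω)`, with the norm `‖f‖_{L^p(ℝ^N)} + [f]_{W^{s,p}(ℝ^N)}`. A class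
`f` is represented by the pair of `f` and its difference quotient, so that the norm is the sum of
two `L^p` norms. With `Ω = univ` this is `W^{s,p}(ℝ^N)`. -/
def W0 (Ω : Set (RN N)) (s p : ℝ) [Fact (1 < p)] : Type := W0Submodule Ω s p

instance instNormedAddCommGroupW0 (Ω : Set (RN N)) (s p : ℝ) [Fact (1 < p)] :
    NormedAddCommGroup (W0 Ω s p) :=
  inferInstanceAs (NormedAddCommGroup (W0Submodule Ω s p))

instance instNormedSpaceW0 (Ω : Set (RN N)) (s p : ℝ) [Fact (1 < p)] :
    NormedSpace ℝ (W0 Ω s p) :=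
  inferInstanceAs (NormedSpace ℝ (W0Submodule Ω s p))

/-- The identification of a pair with the class in `W^{s,p}_0(Ω)` that it represents. -/
def W0.ofPair (Ω : Set (RN N)) (s p : ℝ) [Fact (1 < p)] : W0Submodule Ω s p ≃ₗᵢ[ℝ] W0 Ω s p :=
  LinearIsometryEquiv.refl ℝ (W0Submodule Ω s p)

theorem MemW0.pair_mem {Ω : Set (RN N)} {s p : ℝ} [Fact (1 < p)] {f : RN N → ℝ}
    (h : MemW0 Ω s p f) :
    WithLp.toLp 1 (h.memLp.toLp f, h.memLp_diffQuot.toLp (diffQuot s p f)) ∈ W0Submodule Ω s p :=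
  ⟨f, h, h.memLp.coeFn_toLp, h.memLp_diffQuot.coeFn_toLp⟩

open Classical in
/-- The class in `W^{s,p}_0(Ω)` of a function; it is used only for functions that satisfy
`MemW0 Ω s p`. -/
def toW0 (Ω : Set (RN N)) (s p : ℝ) [Fact (1 < p)] (f : RN N → ℝ) : W0 Ω s p :=
  if h : MemW0 Ω s p f then
    W0.ofPair Ω s p ⟨WithLp.toLp 1 (h.memLp.toLp f, h.memLp_diffQuot.toLp (diffQuot s p f)),
      h.pair_mem⟩
  else 0

/-- Smooth functions with compact support in the open set `Ω`. -/
structure IsTestFun (Ω : Set (RN N)) (ψ : RN N → ℝ) : Prop where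
  smooth : ContDiff ℝ ∞ ψ
  compact : HasCompactSupport ψ
  supp : tsupport ψ ⊆ Ω

/-- `C_c^∞(Ω)` is dense in `W^{s,p}_0(Ω)`. -/
def TestFunDense (Ω : Set (RN N)) (s p : ℝ) [Fact (1 < p)] : Prop :=
  Dense {w : W0 Ω s p | ∃ ψ : RN N → ℝ, IsTestFun Ω ψ ∧ toW0 Ω s p ψ = w}

end FractionalSobolev

section Parabolic

variable {N : ℕ}

/-- The Bochner class `L^p(0,T; W^{s,p}_0(Ω))`; with `Ω = univ` it is `L^p(0,T; W^{s,p}(ℝ^N))`. -/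
structure MemLpW0 (Ω : Set (RN N)) (s p : ℝ) [Fact (1 < p)] (T : ℝ) (u : ℝ → RN N → ℝ) :
    Prop where
  mem : ∀ᵐ t ∂(volume.restrict (Ioo 0 T)), MemW0 Ω s p (u t)
  memLp : MemLp (fun t => toW0 Ω s p (u t)) (ENNReal.ofReal p) (volume.restrict (Ioo 0 T))

/-- The class `C([0,T]; L^2(Ω))`. -/
structure MemCL2 (Ω : Set (RN N)) (T : ℝ) (u : ℝ → RN N → ℝ) : Prop where
  mem : ∀ t ∈ Icc 0 T, MemLp (u t) 2 (volume.restrict Ω)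
  cont : ∀ t₀ ∈ Icc 0 T, Tendsto (fun t => eLpNorm (u t - u t₀) 2 (volume.restrict Ω))
    (𝓝[Icc 0 T] t₀) (𝓝 0)

/-- Smooth functions with compact support in `Ω_T = Ω × (0,T)` (time is the first variable). -/
structure IsSpaceTimeTestFun (Ω : Set (RN N)) (T : ℝ) (φ : ℝ → RN N → ℝ) : Prop where
  smooth : ContDiff ℝ ∞ (fun q : ℝ × RN N => φ q.1 q.2)
  compact : HasCompactSupport (fun q : ℝ × RN N => φ q.1 q.2)
  supp : tsupport (fun q : ℝ × RN N => φ q.1 q.2) ⊆ Ioo 0 T ×ˢ Ω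

/-- `g` is in `L^{p'}(0,T; W^{s,p}_0(Ω)^*)` and is the distributional time derivative of `u` in
`Ω × (0,T)`. -/
structure HasDualTimeDeriv (Ω : Set (RN N)) (s p : ℝ) [Fact (1 < p)] (T : ℝ)
    (u : ℝ → RN N → ℝ) (g : ℝ → StrongDual ℝ (W0 Ω s p)) : Prop where
  memLp : MemLp g (ENNReal.ofReal (p / (p - 1))) (volume.restrict (Ioo 0 T))
  deriv_eq : ∀ φ : ℝ → RN N → ℝ, IsSpaceTimeTestFun Ω T φ →
    ∫ t in Ioo 0 T, g t (toW0 Ω s p (φ t)) =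
      -∫ t in Ioo 0 T, ∫ x in Ω, u t x * deriv (fun r => φ r x) t

/-- `w` is in `L^2(Ω × (0,T))` and is the distributional time derivative of `u` in
`Ω × (0,T)`. -/
structure HasL2TimeDeriv (Ω : Set (RN N)) (T : ℝ) (u w : ℝ → RN N → ℝ) : Prop where
  memLp : MemLp (fun q : ℝ × RN N => w q.1 q.2) 2
    ((volume.restrict (Ioo 0 T)).prod (volume.restrict Ω))
  deriv_eq : ∀ φ : ℝ → RN N → ℝ, IsSpaceTimeTestFun Ω T φ →
    ∫ t in Ioo 0 T, ∫ x in Ω, w t x * φ t x =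
      -∫ t in Ioo 0 T, ∫ x in Ω, u t x * deriv (fun r => φ r x) t

/-- The integrand `H(x,y,ξ) = (1/p) (|ξ| / |x-y|^s)^p` of the fractional `p`-Laplacian. -/
def fracH (s p : ℝ) (x y : RN N) (ξ : ℝ) : ℝ :=
  (1 / p) * (|ξ| / ‖x - y‖ ^ s) ^ p

/-- `u` is a weak solution, up to every finite time `T ≤ Tmax`, of
`∂_t u + P.V. ∫ D_ξ H(x,y,u(x,t)-u(y,t)) / |x-y|^N dy = 0` in `Ω`,
with `u = u₀` outside `Ω` and `∂_t u ∈ L^{p'}(0,T; W^{s,p}_0(Ω)^*)`. -/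
def IsWeakSolution (Ω : Set (RN N)) (s p : ℝ) [Fact (1 < p)] (u₀ : RN N → ℝ) (Tmax : EReal)
    (u : ℝ → RN N → ℝ) : Prop :=
  ∀ T : ℝ, 0 < T → (T : EReal) ≤ Tmax →
    MemLpW0 univ s p T u ∧ MemCL2 Ω T u ∧ MemLpW0 Ω s p T (fun t x => u t x - u₀ x) ∧
    ∃ g : ℝ → StrongDual ℝ (W0 Ω s p), HasDualTimeDeriv Ω s p T u g ∧
      ∀ τ : ℝ, 0 < τ → τ ≤ T → ∀ φ : ℝ → RN N → ℝ, IsSpaceTimeTestFun Ω τ φ →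
        (∫ t in Ioo 0 τ, ∫ z : RN N × RN N,
            deriv (fracH s p z.1 z.2) (u t z.1 - u t z.2) * (φ t z.1 - φ t z.2)
              / ‖z.1 - z.2‖ ^ (N : ℝ))
          + ∫ t in Ioo 0 τ, g t (toW0 Ω s p (φ t)) = 0

/-- `v` is a comparison map on `(0,T)` for the data `u₀`, with time derivative `w`. -/
structure IsComparison (Ω : Set (RN N)) (s p : ℝ) [Fact (1 < p)] (u₀ : RN N → ℝ) (T : ℝ)
    (v w : ℝ → RN N → ℝ) : Prop where
  memW : MemLpW0 univ s p T v
  memW0 : MemLpW0 Ω s p T (fun t x => v t x - u₀ x)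
  memCL2 : MemCL2 Ω T v
  deriv : HasL2TimeDeriv Ω T v w

/-- `u` is a variational solution up to every finite time `T ≤ Tmax`. -/
def IsVariationalSolution (Ω : Set (RN N)) (s p : ℝ) [Fact (1 < p)] (u₀ : RN N → ℝ)
    (Tmax : EReal) (u : ℝ → RN N → ℝ) : Prop :=
  ∀ T : ℝ, 0 < T → (T : EReal) ≤ Tmax →
    MemLpW0 univ s p T u ∧ MemCL2 Ω T u ∧ MemLpW0 Ω s p T (fun t x => u t x - u₀ x) ∧
    ∀ v w : ℝ → RN N → ℝ, IsComparison Ω s p u₀ T v w →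
      (∫ t in Ioo 0 T, ∫ x in Ω, w t x * (v t x - u t x))
        + (∫ t in Ioo 0 T, ∫ z : RN N × RN N,
            (fracH s p z.1 z.2 (v t z.1 - v t z.2) - fracH s p z.1 z.2 (u t z.1 - u t z.2))
              / ‖z.1 - z.2‖ ^ (N : ℝ))
      ≥ (1 / 2) * (∫ x in Ω, (v T x - u T x) ^ 2) - (1 / 2) * ∫ x in Ω, (v 0 x - u 0 x) ^ 2

/-- `u` is a variational solution with the initial datum `u₀`, up to every finite time
`T ≤ Tmax`: the initial datum stands in the inequality in place of `u(·,0)`. -/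
def IsVariationalSolutionWithDatum (Ω : Set (RN N)) (s p : ℝ) [Fact (1 < p)] (u₀ : RN N → ℝ)
    (Tmax : EReal) (u : ℝ → RN N → ℝ) : Prop :=
  ∀ T : ℝ, 0 < T → (T : EReal) ≤ Tmax →
    MemLpW0 univ s p T u ∧ MemCL2 Ω T u ∧ MemLpW0 Ω s p T (fun t x => u t x - u₀ x) ∧
    ∀ v w : ℝ → RN N → ℝ, IsComparison Ω s p u₀ T v w →
      (∫ t in Ioo 0 T, ∫ z : RN N × RN N,
          fracH s p z.1 z.2 (u t z.1 - u t z.2) / ‖z.1 - z.2‖ ^ (N : ℝ))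
      ≤ (∫ t in Ioo 0 T, ∫ z : RN N × RN N,
          fracH s p z.1 z.2 (v t z.1 - v t z.2) / ‖z.1 - z.2‖ ^ (N : ℝ))
        + (∫ t in Ioo 0 T, ∫ x in Ω, w t x * (v t x - u t x))
        + (1 / 2) * (∫ x in Ω, (v 0 x - u₀ x) ^ 2) - (1 / 2) * ∫ x in Ω, (v T x - u T x) ^ 2

end Parabolic

end

/-! Formally, the weak equation is tested with `v - u`. Since `v` and `u` share the datum `u₀`, this
difference lies in `W^{s,p}_0(Ω)` at almost every time. Convexity of `ξ ↦ |ξ|^p / p` bounds the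
first variation of the energy at `u` in the direction `v - u` by the energy of `v` minus that of
`u`, and the time term is `∂_t v - ∂_t u` paired with `v - u`, that is, half the derivative of `‖v -
u‖²` in `L^2(Ω)`.

The difficulty is the last identity. `∂_t u` lies only in the dual of `W^{s,p}_0(Ω)`, and for small
`p` this space need not embed in `L^2(Ω)`, so the chain rule of a Gelfand triple is not at hand.
Only an inequality is needed, and it comes from backward differences. With `L = v - u`, the bound
`‖L t‖²/2 - ‖L t₁‖²/2 ≤ (L t - L t₁, L t)` holds in any Hilbert space. The right side is an
increment tested with the fixed function `L t`, hence equals the integral over `(t₁, t)` of `∂_t v -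
∂_t u` paired with `L t`. Taking `t₁ = t - h`, integrating in `t`, dividing by `h` and letting `h →
0` gives `energy_inequality`; the limit uses continuity of translations in `L^{q'}`
(`tendsto_average_pairing`).

The increment formula `inner_sub_eq_integral` is first proved for smooth test functions by the du
Bois-Reymond lemma (`sub_eq_integral_of_weak_deriv`). It extends to all of `W^{s,p}_0(Ω) ∩ L^2(Ω)`
because test functions are dense there in both norms at once (`TestFunDense.exists_near`):
composition with a smooth bounded contraction keeps test functions and makes `L^2` convergence
automatic on bounded `Ω`.

Finally `ae_weak_formulation` localises the weak equation in time, with one null set for all test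
functions by separability, so that it may be tested with `v t - u t`. -/

noncomputable section

/-! ### Averages over backward time windows of a pairing -/

section TranslationAverage

variable {E F : Type*} [NormedAddCommGroup E] [NormedSpace ℝ E]
  [NormedAddCommGroup F] [NormedSpace ℝ F]

theorem integrable_translate_pairing {q q' : ℝ≥0∞} [ENNReal.HolderConjugate q' q]
    (B : E →L[ℝ] F →L[ℝ] ℝ) {G : ℝ → E} {Z : ℝ → F}
    (hG : MemLp G q' volume) (hZ : MemLp Z q volume) (σ : ℝ) :
    Integrable (fun t => B (G (t - σ)) (Z t)) volume := by
  have h : MemLp (fun t => G (t - σ)) q' volume :=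
    hG.comp_measurePreserving (measurePreserving_sub_right volume σ)
  exact memLp_one_iff_integrable.mp (B.memLp_of_bilin 1 h hZ)

/-- Translations act strongly continuously on `L^{q'}` for finite `q'`, and by Hölder the pairing
with `Z` is a continuous functional on it. -/
theorem continuous_integral_translate_pairing {q q' : ℝ≥0∞} [Fact (1 ≤ q)] [Fact (1 ≤ q')]
    [Fact (q' ≠ ⊤)] [ENNReal.HolderConjugate q' q] (B : E →L[ℝ] F →L[ℝ] ℝ)
    {G : ℝ → E} {Z : ℝ → F} (hG : MemLp G q' volume) (hZ : MemLp Z q volume) :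
    Continuous fun σ : ℝ => ∫ t, B (G (t - σ)) (Z t) := by
  have key : ∀ σ : ℝ, ∫ t, B (G (t - σ)) (Z t) =
      B.lpPairing volume q' q (DomAddAct.mk (-σ) +ᵥ hG.toLp G) (hZ.toLp Z) := by
    intro σ
    rw [ContinuousLinearMap.lpPairing_eq_integral, DomAddAct.mk_vadd_toLp]
    refine integral_congr_ae ?_
    filter_upwards [hZ.coeFn_toLp, MemLp.coeFn_toLp
      (hG.comp_measurePreserving (measurePreserving_vadd (-σ) volume))] with t h1 h2
    rw [h1]
    change _ = B ((MemLp.toLp (G ∘ fun x => -σ +ᵥ x) _ : Lp E q' volume) t) _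
    rw [h2]
    simp [sub_eq_neg_add]
  simp_rw [key]
  have h1 : Continuous fun σ : ℝ => (DomAddAct.mk (-σ) +ᵥ hG.toLp G : Lp E q' volume) :=
    Continuous.vadd (DomAddAct.continuous_mk.comp continuous_neg) continuous_const
  fun_prop

theorem integrable_prod_translate_pairing {q q' : ℝ≥0∞} [Fact (1 ≤ q)] [Fact (1 ≤ q')]
    [Fact (q' ≠ ⊤)] [ENNReal.HolderConjugate q' q] (B : E →L[ℝ] F →L[ℝ] ℝ)
    {G : ℝ → E} {Z : ℝ → F} (hG : MemLp G q' volume) (hZ : MemLp Z q volume) (h : ℝ) :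
    Integrable (fun z : ℝ × ℝ => B (G (z.1 - z.2)) (Z z.1))
      (volume.prod (volume.restrict (Ioc 0 h))) := by
  have hmeas : AEStronglyMeasurable (fun z : ℝ × ℝ => B (G (z.1 - z.2)) (Z z.1))
      (volume.prod (volume.restrict (Ioc 0 h))) := by
    have h1 : AEStronglyMeasurable (fun z : ℝ × ℝ => G (z.1 - z.2)) (volume.prod volume) :=
      hG.1.comp_quasiMeasurePreserving (quasiMeasurePreserving_sub_of_right_invariant volume volume)
    have h2 : AEStronglyMeasurable (fun z : ℝ × ℝ => G (z.1 - z.2))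
        (volume.prod (volume.restrict (Ioc 0 h))) := by
      refine h1.mono_ac ?_
      exact Measure.AbsolutelyContinuous.prod Measure.AbsolutelyContinuous.rfl
        Measure.absolutelyContinuous_restrict
    exact B.aestronglyMeasurable_comp₂ h2 hZ.1.comp_fst
  rw [integrable_prod_iff' hmeas]
  refine ⟨ae_of_all _ fun σ => integrable_translate_pairing B hG hZ σ, ?_⟩
  -- The norms of `G` and `Z`, paired by multiplication, give a majorant continuous in `σ`, hence
  -- integrable on the bounded window.
  have hc : Continuous fun σ : ℝ => ‖B‖ * ∫ t, ‖G (t - σ)‖ * ‖Z t‖ := by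
    have := continuous_integral_translate_pairing (ContinuousLinearMap.mul ℝ ℝ) hG.norm hZ.norm
    simp only [ContinuousLinearMap.mul_apply'] at this
    fun_prop
  refine (hc.integrableOn_Ioc (μ := volume) (a := 0) (b := h)).mono'
    hmeas.norm.prod_swap.integral_prod_right' ?_
  refine ae_of_all _ fun σ => ?_
  rw [Real.norm_of_nonneg (by positivity), ← integral_const_mul]
  refine integral_mono (integrable_translate_pairing B hG hZ σ).norm ?_ fun t => ?_
  · have := integrable_translate_pairing (ContinuousLinearMap.mul ℝ ℝ) hG.norm hZ.norm σ
    simp only [ContinuousLinearMap.mul_apply'] at this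
    exact this.const_mul _
  · simpa [mul_assoc] using B.le_opNorm₂ (G (t - σ)) (Z t)

theorem intervalIntegral_pairing_eq {G : ℝ → E} {Z : ℝ → F} (B : E →L[ℝ] F →L[ℝ] ℝ)
    {h : ℝ} (hh : 0 < h) (t : ℝ) :
    ∫ r in (t - h)..t, B (G r) (Z t) = ∫ σ in Ioc 0 h, B (G (t - σ)) (Z t) := by
  rw [← intervalIntegral.integral_of_le hh.le,
    intervalIntegral.integral_comp_sub_left (fun r => B (G r) (Z t)) t, sub_zero]

theorem integrable_average_pairing {q q' : ℝ≥0∞} [Fact (1 ≤ q)] [Fact (1 ≤ q')]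
    [Fact (q' ≠ ⊤)] [ENNReal.HolderConjugate q' q] (B : E →L[ℝ] F →L[ℝ] ℝ)
    {G : ℝ → E} {Z : ℝ → F} (hG : MemLp G q' volume) (hZ : MemLp Z q volume)
    {h : ℝ} (hh : 0 < h) :
    Integrable (fun t => ∫ r in (t - h)..t, B (G r) (Z t)) volume := by
  simp_rw [intervalIntegral_pairing_eq B hh]
  exact (integrable_prod_translate_pairing B hG hZ h).integral_prod_left

/-- By Fubini the double integral is that of `K σ = ∫ B (G (t - σ)) (Z t) dt` over `(0, h]`. Since
`K` is continuous, its mean tends to `K 0`. -/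
theorem tendsto_average_pairing {q q' : ℝ≥0∞} [Fact (1 ≤ q)] [Fact (1 ≤ q')]
    [Fact (q' ≠ ⊤)] [ENNReal.HolderConjugate q' q] (B : E →L[ℝ] F →L[ℝ] ℝ)
    {G : ℝ → E} {Z : ℝ → F} (hG : MemLp G q' volume) (hZ : MemLp Z q volume) :
    Tendsto (fun h : ℝ => h⁻¹ * ∫ t, ∫ r in (t - h)..t, B (G r) (Z t)) (𝓝[>] 0)
      (𝓝 (∫ t, B (G t) (Z t))) := by
  have hK := continuous_integral_translate_pairing B hG hZ
  have hd := (intervalIntegral.integral_hasDerivAt_right (hK.intervalIntegrable 0 0)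
    (hK.stronglyMeasurableAtFilter _ _) hK.continuousAt)
  have hs := (hasDerivAt_iff_tendsto_slope_zero.mp hd).mono_left
    (nhdsWithin_mono 0 (fun x (hx : 0 < x) => hx.ne') : 𝓝[>] (0 : ℝ) ≤ 𝓝[≠] 0)
  simp only [sub_zero, zero_add, intervalIntegral.integral_same, smul_eq_mul] at hs
  refine hs.congr' ?_
  filter_upwards [self_mem_nhdsWithin] with h hh
  have hh : 0 < h := hh
  simp_rw [intervalIntegral_pairing_eq B hh]
  rw [intervalIntegral.integral_of_le hh.le]
  exact congrArg _ (integral_integral_swap (f := fun σ t => B (G (t - σ)) (Z t))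
    (integrable_prod_translate_pairing B hG hZ h).swap)

end TranslationAverage

/-! ### The energy inequality by backward differences -/

section Energy

/-- The integral telescopes: only the mean of `n` over `[T - h, T]` minus its mean over `[-h, 0]`
survives. -/
theorem tendsto_average_sub {n : ℝ → ℝ} (hn : Continuous n) (T : ℝ) :
    Tendsto (fun h : ℝ => h⁻¹ * ∫ t in 0..T, (n t - n (t - h))) (𝓝[>] 0) (𝓝 (n T - n 0)) := by
  have main : ∀ a : ℝ, Tendsto (fun h : ℝ => h⁻¹ * ∫ t in (a - h)..a, n t) (𝓝[>] 0) (𝓝 (n a)) := by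
    intro a
    have hd : HasDerivAt (fun h : ℝ => ∫ t in (a - h)..a, n t) (n a) 0 := by
      have h1 := (intervalIntegral.integral_hasDerivAt_left (hn.intervalIntegrable (a - 0) a)
        (hn.stronglyMeasurableAtFilter _ _) hn.continuousAt)
      have h2 : HasDerivAt (fun h : ℝ => a - h) (-1) 0 := by
        simpa using (hasDerivAt_id (0 : ℝ)).const_sub a
      have h3 := h1.comp (0 : ℝ) h2
      rw [neg_mul_neg, sub_zero, mul_one] at h3
      exact h3
    have hs := (hasDerivAt_iff_tendsto_slope_zero.mp hd).mono_left
      (nhdsWithin_mono 0 (fun x (hx : 0 < x) => hx.ne') : 𝓝[>] (0 : ℝ) ≤ 𝓝[≠] 0)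
    simpa using hs
  refine ((main T).sub (main 0)).congr fun h => ?_
  rw [← mul_sub]
  congr 1
  have hn' : Continuous fun t => n (t - h) := hn.comp (continuous_id.sub continuous_const)
  rw [intervalIntegral.integral_sub (hn.intervalIntegrable _ _) (hn'.intervalIntegrable _ _),
    intervalIntegral.integral_comp_sub_right n h]
  have e1 := intervalIntegral.integral_add_adjacent_intervals
    (hn.intervalIntegrable (μ := volume) (0 - h) 0) (hn.intervalIntegrable 0 (T - h))
  have e2 := intervalIntegral.integral_add_adjacent_intervals
    (hn.intervalIntegrable (μ := volume) 0 (T - h)) (hn.intervalIntegrable (T - h) T)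
  linarith

/-- The energy inequality for a continuous curve `L` in a Hilbert space with derivative `W - g`,
where `g` takes values in a space that is paired by `B₂` with a space in which the
curve is represented by `Z`. -/
theorem energy_inequality {D E H : Type*} [NormedAddCommGroup D] [NormedSpace ℝ D]
    [NormedAddCommGroup E] [NormedSpace ℝ E]
    [NormedAddCommGroup H] [InnerProductSpace ℝ H] {q q' : ℝ≥0∞} [Fact (1 ≤ q)] [Fact (1 ≤ q')]
    [Fact (q' ≠ ⊤)] [ENNReal.HolderConjugate q' q] {T : ℝ} (hT : 0 < T)
    {L W : ℝ → H} {Z : ℝ → E} {g : ℝ → D}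
    (B₂ : D →L[ℝ] E →L[ℝ] ℝ)
    (hL : ContinuousOn L (Icc 0 T)) (hW : MemLp W 2 (volume.restrict (Ioo 0 T)))
    (hZ : MemLp Z q (volume.restrict (Ioo 0 T))) (hg : MemLp g q' (volume.restrict (Ioo 0 T)))
    (hI : ∀ᵐ t ∂(volume.restrict (Ioo 0 T)), ∀ t₁ ∈ Icc 0 t,
      inner ℝ (L t - L t₁) (L t) = ∫ r in t₁..t, (inner ℝ (W r) (L t) - B₂ (g r) (Z t))) :
    (1 / 2) * ‖L T‖ ^ 2 - (1 / 2) * ‖L 0‖ ^ 2 ≤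
      (∫ t in Ioo 0 T, inner ℝ (W t) (L t)) - ∫ t in Ioo 0 T, B₂ (g t) (Z t) := by
  have : Fact ((2 : ℝ≥0∞) ≠ ⊤) := ⟨by simp⟩
  set S : Set ℝ := Ioo 0 T with hS
  have hSm : MeasurableSet S := measurableSet_Ioo
  have hLm : MemLp L 2 (volume.restrict S) := by
    obtain ⟨C, hC⟩ := isCompact_Icc.exists_bound_of_continuousOn hL
    refine MemLp.of_bound ((hL.mono Ioo_subset_Icc_self).aestronglyMeasurable hSm) C ?_
    filter_upwards [ae_restrict_mem hSm] with t ht using hC t (Ioo_subset_Icc_self ht)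
  have hL' : MemLp (S.indicator L) 2 volume := (memLp_indicator_iff_restrict hSm).mpr hLm
  have hW' : MemLp (S.indicator W) 2 volume := (memLp_indicator_iff_restrict hSm).mpr hW
  have hZ' : MemLp (S.indicator Z) q volume := (memLp_indicator_iff_restrict hSm).mpr hZ
  have hg' : MemLp (S.indicator g) q' volume := (memLp_indicator_iff_restrict hSm).mpr hg
  obtain ⟨B₁, hB₁⟩ : ∃ B : H →L[ℝ] H →L[ℝ] ℝ, ∀ x y, B x y = inner ℝ x y :=
    ⟨innerSL ℝ, fun _ _ => rfl⟩
  have lim₁ := tendsto_average_pairing B₁ hW' hL'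
  have lim₂ := tendsto_average_pairing B₂ hg' hZ'
  have e₁ : ∫ t, B₁ (S.indicator W t) (S.indicator L t) = ∫ t in S, inner ℝ (W t) (L t) := by
    rw [← integral_indicator hSm]
    congr 1 with t
    by_cases ht : t ∈ S <;> simp [ht, hB₁]
  have e₂ : ∫ t, B₂ (S.indicator g t) (S.indicator Z t) = ∫ t in S, B₂ (g t) (Z t) := by
    rw [← integral_indicator hSm]
    congr 1 with t
    by_cases ht : t ∈ S <;> simp [ht]
  rw [e₁] at lim₁
  rw [e₂] at lim₂
  -- Here `L` is continued by its end values, which keeps `n` continuous; in the pairings all curves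
  -- are continued by zero instead.
  set n : ℝ → ℝ := fun t => (1 / 2) * ‖IccExtend hT.le ((Icc 0 T).domRestrict L) t‖ ^ 2 with hn
  have hnc : Continuous n := by
    have : Continuous (IccExtend hT.le ((Icc 0 T).domRestrict L)) :=
      (continuousOn_iff_continuous_domRestrict.mp hL).Icc_extend'
    fun_prop
  have hnT : n T = (1 / 2) * ‖L T‖ ^ 2 := by simp [hn, domRestrict]
  have hn0 : n 0 = (1 / 2) * ‖L 0‖ ^ 2 := by simp [hn, domRestrict]
  have lim₃ := tendsto_average_sub hnc T
  rw [← hnT, ← hn0]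
  refine le_of_tendsto_of_tendsto lim₃ (lim₁.sub lim₂) ?_
  filter_upwards [self_mem_nhdsWithin] with h hh
  have hh : 0 < h := hh
  rw [← mul_sub]
  refine mul_le_mul_of_nonneg_left ?_ (inv_nonneg.mpr hh.le)
  have i₁ := integrable_average_pairing B₁ hW' hL' hh
  have i₂ := integrable_average_pairing B₂ hg' hZ' hh
  rw [← integral_sub i₁ i₂, intervalIntegral.integral_of_le hT.le, integral_Ioc_eq_integral_Ioo,
    ← setIntegral_eq_integral_of_forall_compl_eq_zero (s := S) (f := fun t =>
      (∫ r in (t - h)..t, B₁ (S.indicator W r) (S.indicator L t)) -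
        ∫ r in (t - h)..t, B₂ (S.indicator g r) (S.indicator Z t))
      (fun t ht => by simp only [indicator_of_notMem ht, map_zero]; simp)]
  refine integral_mono_ae ?_ (i₁.sub i₂).restrict ?_
  · exact ((hnc.sub (hnc.comp (continuous_id.sub continuous_const))).integrableOn_Icc).mono_set
      Ioo_subset_Icc_self
  filter_upwards [hI, ae_restrict_mem hSm] with t hIt ht
  have htS : t ∈ S := ht
  -- Extension by zero cuts the window `(t - h, t]` at time `0`, so `hI` applies with `t₁ = max (t -
  -- h) 0`. The constant continuation of `L` gives the matching value `n (t - h)`, also when `t <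
  -- h`.
  have hloc : ∀ φ : ℝ → ℝ,
      ∫ r in (t - h)..t, S.indicator φ r = ∫ r in (max (t - h) 0)..t, φ r := by
    intro φ
    rw [intervalIntegral.integral_of_le (by linarith),
      intervalIntegral.integral_of_le (max_le (by linarith) ht.1.le), setIntegral_indicator hSm]
    congr 2
    ext r
    simp only [hS, mem_inter_iff, mem_Ioc, mem_Ioo, max_lt_iff]
    exact ⟨fun hr => ⟨⟨hr.1.1, hr.2.1⟩, hr.1.2⟩,
      fun hr => ⟨⟨hr.1.1, hr.2⟩, hr.1.2, hr.2.trans_lt ht.2⟩⟩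
  have f₁ : ∫ r in (t - h)..t, B₁ (S.indicator W r) (S.indicator L t) =
      ∫ r in (max (t - h) 0)..t, inner ℝ (W r) (L t) := by
    rw [← hloc]
    congr 1 with r
    by_cases hr : r ∈ S <;> simp [hr, htS, hB₁]
  have f₂ : ∫ r in (t - h)..t, B₂ (S.indicator g r) (S.indicator Z t) =
      ∫ r in (max (t - h) 0)..t, B₂ (g r) (Z t) := by
    rw [← hloc]
    congr 1 with r
    by_cases hr : r ∈ S <;> simp [hr, htS]
  have ht₁ : max (t - h) 0 ∈ Icc 0 t := ⟨le_max_right _ _, max_le (by linarith) ht.1.le⟩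
  have hsub : Ioc (max (t - h) 0) t ⊆ S := fun r hr =>
    ⟨(le_max_right _ _).trans_lt hr.1, hr.2.trans_lt ht.2⟩
  have j₁ : IntervalIntegrable (fun r => inner ℝ (W r) (L t)) volume (max (t - h) 0) t := by
    rw [intervalIntegrable_iff_integrableOn_Ioc_of_le ht₁.2]
    have : IntegrableOn W S volume := hW.integrable (by norm_num)
    exact (this.mono_set hsub).inner_const (L t)
  have j₂ : IntervalIntegrable (fun r => B₂ (g r) (Z t)) volume (max (t - h) 0) t := by
    rw [intervalIntegrable_iff_integrableOn_Ioc_of_le ht₁.2]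
    have : IntegrableOn g S volume := hg.integrable Fact.out
    exact (B₂.flip (Z t)).integrable_comp (this.mono_set hsub)
  change _ ≤ _ - _
  rw [f₁, f₂, ← intervalIntegral.integral_sub j₁ j₂, ← hIt _ ht₁]
  have n₁ : n t = (1 / 2) * ‖L t‖ ^ 2 := by
    simp [hn, IccExtend_of_mem hT.le _ (Ioo_subset_Icc_self ht), domRestrict]
  have n₂ : n (t - h) = (1 / 2) * ‖L (max (t - h) 0)‖ ^ 2 := by
    have : t - h ≤ T := by linarith [ht.2]
    simp [hn, IccExtend, projIcc, domRestrict, max_comm, min_eq_right this]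
  -- With `a = L t` and `b = L t₁` this is `‖a‖²/2 - ‖b‖²/2 ≤ (a - b, a)`, from Cauchy-Schwarz and
  -- `(‖b‖ - ‖a‖)² ≥ 0`.
  rw [n₁, n₂, inner_sub_left, real_inner_self_eq_norm_sq]
  have := real_inner_le_norm (L (max (t - h) 0)) (L t)
  nlinarith [sq_nonneg (‖L (max (t - h) 0)‖ - ‖L t‖)]

end Energy

/-! ### The du Bois-Reymond lemma in time -/

section DuBoisReymond

theorem exists_Icc_of_isCompact_subset_Ioo {K : Set ℝ} {T : ℝ} (hT : 0 < T) (hK : IsCompact K)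
    (hKT : K ⊆ Ioo 0 T) : ∃ α β : ℝ, 0 < α ∧ β < T ∧ K ⊆ Icc α β := by
  rcases K.eq_empty_or_nonempty with rfl | hne
  · exact ⟨T / 2, T / 2, by linarith, by linarith, empty_subset _⟩
  · obtain ⟨α, hα⟩ := hK.exists_isLeast hne
    obtain ⟨β, hβ⟩ := hK.exists_isGreatest hne
    exact ⟨α, β, (hKT hα.1).1, (hKT hβ.1).2, fun x hx => ⟨hα.2 hx, hβ.2 hx⟩⟩

/-- The primitive from `0` vanishes to the left of the support of `c`, and to the right of it
because the total integral is zero. -/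
theorem exists_primitive_compactSupport {T : ℝ} (hT : 0 < T) {c : ℝ → ℝ} (hc : ContDiff ℝ ∞ c)
    (hcs : HasCompactSupport c) (hct : tsupport c ⊆ Ioo 0 T) (hc0 : ∫ t in 0..T, c t = 0) :
    ∃ η : ℝ → ℝ, ContDiff ℝ ∞ η ∧ HasCompactSupport η ∧ tsupport η ⊆ Ioo 0 T ∧ deriv η = c ∧
      AbsolutelyContinuousOnInterval η 0 T := by
  have hd : ∀ x, HasDerivAt (fun x => ∫ t in 0..x, c t) (c x) x := fun x =>
    intervalIntegral.integral_hasDerivAt_right (hc.continuous.intervalIntegrable _ _)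
      (hc.continuous.stronglyMeasurableAtFilter _ _) hc.continuous.continuousAt
  obtain ⟨α, β, hα, hβ, hsub⟩ := exists_Icc_of_isCompact_subset_Ioo hT hcs hct
  have hz : ∀ x, x ∉ Icc α β → c x = 0 := fun x hx =>
    image_eq_zero_of_notMem_tsupport fun h => hx (hsub h)
  have hsupp : tsupport (fun x => ∫ t in 0..x, c t) ⊆ Icc α β := by
    refine closure_minimal (fun x hx => ?_) isClosed_Icc
    by_contra hxn
    refine hx ?_
    rw [mem_Icc, not_and_or, not_le, not_le] at hxn
    rcases hxn with h | h
    · refine intervalIntegral.integral_zero_ae (ae_of_all _ fun t ht => hz t fun h' => ?_)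
      have := ht.2
      rcases le_max_iff.mp this with h1 | h1 <;> linarith [h'.1]
    · have e := intervalIntegral.integral_add_adjacent_intervals
        (hc.continuous.intervalIntegrable (μ := volume) 0 x) (hc.continuous.intervalIntegrable x T)
      have : ∫ t in x..T, c t = 0 := by
        refine intervalIntegral.integral_zero_ae (ae_of_all _ fun t ht => hz t fun h' => ?_)
        have := ht.1
        rcases min_lt_iff.mp this with h1 | h1 <;> linarith [h'.2]
      simpa [this, hc0] using e
  have hder : deriv (fun x => ∫ t in 0..x, c t) = c := funext fun x => (hd x).deriv
  refine ⟨fun x => ∫ t in 0..x, c t, ?_, ?_, ?_, hder, ?_⟩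
  · rw [contDiff_infty_iff_deriv, hder]
    exact ⟨fun x => (hd x).differentiableAt, hc⟩
  · exact isCompact_Icc.of_isClosed_subset (isClosed_tsupport _) hsupp
  · exact hsupp.trans fun x hx => ⟨hα.trans_le hx.1, hx.2.trans_lt hβ⟩
  · have := hc.continuous.intervalIntegrable (μ := volume) 0 T
    exact this.absolutelyContinuousOnInterval_intervalIntegral (by simp)

/-- A continuous function whose distributional derivative is an integrable function `b` is a
primitive of `b`. -/
theorem sub_eq_integral_of_weak_deriv {T : ℝ} (hT : 0 < T) {a b : ℝ → ℝ}
    (ha : ContinuousOn a (Icc 0 T)) (hb : IntegrableOn b (Ioo 0 T))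
    (h : ∀ η : ℝ → ℝ, ContDiff ℝ ∞ η → HasCompactSupport η → tsupport η ⊆ Ioo 0 T →
      ∫ t in Ioo 0 T, η t * b t = -∫ t in Ioo 0 T, deriv η t * a t)
    {t₁ t₂ : ℝ} (ht₁ : t₁ ∈ Icc 0 T) (ht₂ : t₂ ∈ Icc 0 T) :
    a t₂ - a t₁ = ∫ t in t₁..t₂, b t := by
  have hbi : IntervalIntegrable b volume 0 T := by
    rwa [intervalIntegrable_iff_integrableOn_Ioo_of_le hT.le]
  set P : ℝ → ℝ := fun x => ∫ t in 0..x, b t with hP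
  have hPac : AbsolutelyContinuousOnInterval P 0 T :=
    hbi.absolutelyContinuousOnInterval_intervalIntegral (by simp)
  have hPc : ContinuousOn P (Icc 0 T) := by simpa [uIcc_of_le hT.le] using hPac.continuousOn
  have hmc : ContinuousOn (fun t => a t - P t) (Icc 0 T) := ha.sub hPc
  have toIoo : ∀ f : ℝ → ℝ, ∫ t in 0..T, f t = ∫ t in Ioo 0 T, f t := fun f => by
    rw [intervalIntegral.integral_of_le hT.le, integral_Ioc_eq_integral_Ioo]
  have intg : ∀ c f : ℝ → ℝ, Continuous c → ContinuousOn f (Icc 0 T) →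
      IntegrableOn (fun t => c t * f t) (Ioo 0 T) := fun c f hc hf =>
    ((hc.continuousOn.mul hf).integrableOn_Icc).mono_set Ioo_subset_Icc_self
  -- the difference of `a` and the primitive is orthogonal to test functions of mean zero
  have orth : ∀ c : ℝ → ℝ, ContDiff ℝ ∞ c → HasCompactSupport c → tsupport c ⊆ Ioo 0 T →
      ∫ t in 0..T, c t = 0 → ∫ t in Ioo 0 T, c t * (a t - P t) = 0 := by
    intro c hc hcs hct hc0
    obtain ⟨η, h1, h2, h3, h4, h5⟩ := exists_primitive_compactSupport hT hc hcs hct hc0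
    have k1 := h η h1 h2 h3
    -- `P` is only absolutely continuous, since `b` is merely integrable; that suffices for
    -- integration by parts.
    have k2 := h5.integral_mul_deriv_eq_deriv_mul hPac
    have hη0 : η 0 = 0 := image_eq_zero_of_notMem_tsupport fun h => (h3 h).1.false
    have hηT : η T = 0 := image_eq_zero_of_notMem_tsupport fun h => (h3 h).2.false
    have k3 : ∫ t in 0..T, η t * deriv P t = ∫ t in 0..T, η t * b t := by
      refine intervalIntegral.integral_congr_ae ?_
      filter_upwards [hbi.ae_hasDerivAt_integral] with x hx hx'
      rw [(hx (uIoc_subset_uIcc hx') 0 (by simp)).deriv]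
    rw [h4] at k1 k2
    rw [hη0, hηT, k3, toIoo, toIoo, k1] at k2
    simp only [mul_sub]
    rw [integral_sub (intg c a hc.continuous ha) (intg c P hc.continuous hPc)]
    linarith
  obtain ⟨ρ, hρT, hρs, hρ, hρ1⟩ : ∃ ρ : ℝ → ℝ, tsupport ρ ⊆ Ioo 0 T ∧ HasCompactSupport ρ ∧
      ContDiff ℝ ∞ ρ ∧ ∫ t in 0..T, ρ t = 1 := by
    let f : ContDiffBump (T / 2) := ⟨T / 8, T / 4, by linarith, by linarith⟩
    have hs : tsupport (f.normed volume) ⊆ Ioo 0 T := by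
      rw [f.tsupport_normed_eq, Real.closedBall_eq_Icc]
      intro x hx
      have h1 : T / 2 - T / 4 ≤ x := hx.1
      have h2 : x ≤ T / 2 + T / 4 := hx.2
      exact ⟨by linarith, by linarith⟩
    refine ⟨f.normed volume, hs, f.hasCompactSupport_normed, f.contDiff_normed, ?_⟩
    rw [toIoo, setIntegral_eq_integral_of_forall_compl_eq_zero
      (fun x hx => image_eq_zero_of_notMem_tsupport fun h => hx (hs h)), f.integral_normed]
  set κ := ∫ t in Ioo 0 T, ρ t * (a t - P t) with hκ
  have hae : ∀ᵐ t, t ∈ Ioo 0 T → a t - P t - κ = 0 := by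
    refine isOpen_Ioo.ae_eq_zero_of_integral_contDiff_smul_eq_zero ?_ ?_
    · exact (((hmc.sub continuousOn_const).integrableOn_Icc).mono_set
        Ioo_subset_Icc_self).locallyIntegrableOn
    intro φ hφ hφs hφT
    -- Subtracting `m * ρ`, where `ρ` has integral one, makes the test function mean-free. Thus `a -
    -- P` is almost everywhere the constant `κ`, its mean against `ρ`.
    set m := ∫ t in 0..T, φ t with hm
    have hsum : tsupport (fun t => φ t - m * ρ t) ⊆ Ioo 0 T := by
      refine (tsupport_sub φ (fun t => m * ρ t)).trans (union_subset hφT ?_)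
      exact (closure_mono (Function.support_mul_subset_right (fun _ => m) ρ)).trans hρT
    have hi : ∀ f : ℝ → ℝ, Continuous f → IntervalIntegrable f volume 0 T :=
      fun f hf => hf.intervalIntegrable _ _
    have := orth (fun t => φ t - m * ρ t) (hφ.sub (contDiff_const.mul hρ))
      (hφs.sub (hρs.mul_left (f := fun _ => m))) hsum (by
        rw [intervalIntegral.integral_sub (hi _ hφ.continuous)
          (hi (fun t => m * ρ t) (continuous_const.mul hρ.continuous)),
          intervalIntegral.integral_const_mul, hρ1]
        simp [hm])
    have e : ∀ t, (φ t - m * ρ t) * (a t - P t) = φ t * (a t - P t) - m * (ρ t * (a t - P t)) :=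
      fun t => by ring
    simp only [e] at this
    rw [integral_sub (intg φ _ hφ.continuous hmc) ((intg ρ _ hρ.continuous hmc).const_mul m),
      integral_const_mul, ← hκ] at this
    rw [← setIntegral_eq_integral_of_forall_compl_eq_zero (s := Ioo 0 T)
      (fun x hx => by simp [image_eq_zero_of_notMem_tsupport fun h => hx (hφT h)])]
    simp only [smul_eq_mul, mul_sub (φ _) _ κ]
    rw [integral_sub (intg φ _ hφ.continuous hmc) (intg φ _ hφ.continuous continuousOn_const),
      integral_mul_const, ← toIoo, ← toIoo]
    rw [← toIoo] at this
    exact this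
  have heq : EqOn (fun t => a t - P t) (fun _ => κ) (Icc 0 T) := by
    refine Measure.eqOn_Icc_of_ae_eq volume hT.ne ?_ hmc continuousOn_const
    rw [← Measure.restrict_congr_set Ioo_ae_eq_Icc]
    filter_upwards [(ae_restrict_iff' measurableSet_Ioo).mpr hae] with t ht
    linarith
  have q1 := heq ht₁
  have q2 := heq ht₂
  simp only [hP] at q1 q2
  have hs : ∀ {x y}, x ∈ Icc 0 T → y ∈ Icc 0 T → IntervalIntegrable b volume x y := fun hx hy =>
    hbi.mono_set (by rw [uIcc_of_le hT.le]; exact uIcc_subset_Icc hx hy)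
  have := intervalIntegral.integral_add_adjacent_intervals
    (hs (left_mem_Icc.mpr hT.le) ht₁) (hs ht₁ ht₂)
  linarith

end DuBoisReymond

/-! ### Convergence in `L^q` with varying dominating functions -/

section DominatedLp

/-- Dominated convergence in `L^p` with dominating functions that converge in `L^p`. -/
theorem tendsto_eLpNorm_sub_of_dominated {α : Type*} {m : MeasurableSpace α} {μ : Measure α}
    {q : ℝ≥0∞} (hq : 1 ≤ q) (hq' : q ≠ ⊤) {f g : ℕ → α → ℝ} {F G : α → ℝ}
    (hf : ∀ n, MemLp (f n) q μ) (hF : MemLp F q μ)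
    (hfF : Tendsto (fun n => eLpNorm (f n - F) q μ) atTop (𝓝 0))
    (hg : ∀ n, AEStronglyMeasurable (g n) μ) (hG : MemLp G q μ) (hle : ∀ n x, ‖g n x‖ ≤ ‖f n x‖)
    (hgG : ∀ᵐ x ∂μ, Tendsto (fun n => g n x) atTop (𝓝 (G x))) :
    Tendsto (fun n => eLpNorm (g n - G) q μ) atTop (𝓝 0) := by
  have hind : ∀ n (S : Set α), eLpNorm (S.indicator (g n)) q μ ≤ eLpNorm (S.indicator (f n)) q μ :=
    fun n S => eLpNorm_mono fun x => by
      by_cases hx : x ∈ S <;> simp only [hx, indicator_of_mem, indicator_of_notMem, hle,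
        not_false_eq_true, le_refl]
  -- Vitali's theorem, used both ways: convergence of `f n` yields uniform integrability and
  -- tightness, which pass to the smaller functions `g n`.
  obtain ⟨-, hui, hut⟩ := (tendstoInMeasure_iff_tendsto_Lp hq hq' hf hF).mpr hfF
  refine tendsto_Lp_of_tendsto_ae hq hq' hg hG ?_ ?_ hgG
  · intro ε hε
    obtain ⟨δ, hδ, h⟩ := hui hε
    exact ⟨δ, hδ, fun i S hS hμ => (hind i S).trans (h i S hS hμ)⟩
  · intro ε hε
    obtain ⟨S, hS, h⟩ := hut hε
    exact ⟨S, hS, fun i => (hind i _).trans (h i)⟩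

end DominatedLp

/-! ### Smooth bounded contractions approximating the identity -/

section SmoothTruncation

/-- A smooth bounded approximation of the identity. -/
def smoothTrunc (n : ℕ) (r : ℝ) : ℝ := (n + 1) * Real.arctan (r / (n + 1))

theorem smoothTrunc_zero (n : ℕ) : smoothTrunc n 0 = 0 := by simp [smoothTrunc]

theorem contDiff_smoothTrunc (n : ℕ) : ContDiff ℝ ∞ (smoothTrunc n) := by
  unfold smoothTrunc
  exact contDiff_const.mul (Real.contDiff_arctan.comp (contDiff_id.div_const _))

theorem abs_smoothTrunc_sub_le (n : ℕ) (a b : ℝ) :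
    |smoothTrunc n a - smoothTrunc n b| ≤ |a - b| := by
  have hL : LipschitzWith 1 Real.arctan := by
    refine lipschitzWith_of_nnnorm_deriv_le Real.differentiable_arctan fun x => ?_
    rw [← NNReal.coe_le_coe, coe_nnnorm, Real.deriv_arctan, Real.norm_of_nonneg (by positivity)]
    simpa using inv_le_one_of_one_le₀ (by nlinarith [sq_nonneg x] : (1 : ℝ) ≤ 1 + x ^ 2)
  have hn : (0 : ℝ) < n + 1 := by positivity
  have h := hL.dist_le_mul (a / (n + 1)) (b / (n + 1))
  rw [Real.dist_eq, Real.dist_eq, ← sub_div, abs_div, abs_of_pos hn, NNReal.coe_one, one_mul,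
    le_div_iff₀ hn] at h
  rw [smoothTrunc, smoothTrunc, ← mul_sub, abs_mul, abs_of_pos hn, mul_comm]
  exact h

theorem abs_smoothTrunc_le_abs (n : ℕ) (a : ℝ) : |smoothTrunc n a| ≤ |a| := by
  simpa [smoothTrunc_zero] using abs_smoothTrunc_sub_le n a 0

theorem abs_smoothTrunc_le (n : ℕ) (a : ℝ) : |smoothTrunc n a| ≤ (n + 1) * (Real.pi / 2) := by
  have hn : (0 : ℝ) < n + 1 := by positivity
  rw [smoothTrunc, abs_mul, abs_of_pos hn]
  refine mul_le_mul_of_nonneg_left (abs_le.mpr ⟨?_, ?_⟩) hn.le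
  · exact (Real.neg_pi_div_two_lt_arctan _).le
  · exact (Real.arctan_lt_pi_div_two _).le

/-- `smoothTrunc n a` is the slope at `0`, with step `1 / (n + 1)`, of `y ↦ arctan (a * y)`, whose
derivative there is `a`. -/
theorem tendsto_smoothTrunc (a : ℝ) : Tendsto (fun n => smoothTrunc n a) atTop (𝓝 a) := by
  have hd : HasDerivAt (fun y : ℝ => Real.arctan (a * y)) a 0 := by
    have h1 : HasDerivAt (fun y : ℝ => a * y) a 0 := by
      simpa using (hasDerivAt_id (0 : ℝ)).const_mul a
    simpa using h1.arctan
  have hs := hasDerivAt_iff_tendsto_slope_zero.mp hd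
  have hy : Tendsto (fun n : ℕ => 1 / ((n : ℝ) + 1)) atTop (𝓝[≠] 0) :=
    tendsto_nhdsWithin_iff.mpr ⟨tendsto_one_div_add_atTop_nhds_zero_nat,
      Eventually.of_forall fun n => by simp only [mem_compl_iff, mem_singleton_iff]; positivity⟩
  refine (hs.comp hy).congr fun n => ?_
  simp [smoothTrunc, div_eq_mul_inv]

end SmoothTruncation

/-! ### Linear structure, norm and separability of `W^{s,p}_0(Ω)` -/

section FractionalSobolevBasics

variable {N : ℕ} {Ω : Set (RN N)} {s p : ℝ}

theorem diffQuot_sub (s p : ℝ) (f g : RN N → ℝ) :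
    diffQuot s p (f - g) = diffQuot s p f - diffQuot s p g := by
  funext z; simp only [diffQuot, Pi.sub_apply]; ring

theorem MemW0.sub {f g : RN N → ℝ} (hf : MemW0 Ω s p f) (hg : MemW0 Ω s p g) :
    MemW0 Ω s p (f - g) := by
  have := hf.add (hg.smul (-1))
  rwa [neg_one_smul, ← sub_eq_add_neg] at this

theorem MemW0.of_smul {f : RN N → ℝ} {c : ℝ} (hc : c ≠ 0) (hf : MemW0 Ω s p (c • f)) :
    MemW0 Ω s p f := by
  simpa [smul_smul, inv_mul_cancel₀ hc] using hf.smul c⁻¹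

instance factOfRealNeTop (p : ℝ) : Fact (ENNReal.ofReal p ≠ ⊤) := ⟨ENNReal.ofReal_ne_top⟩

variable [Fact (1 < p)]

/-- The class of the function underlying an element of `W^{s,p}_0(Ω)`. -/
def W0.fstL (Ω : Set (RN N)) (s p : ℝ) [Fact (1 < p)] :
    W0 Ω s p →L[ℝ] Lp ℝ (ENNReal.ofReal p) (volume : Measure (RN N)) :=
  (WithLp.fstL 1 ℝ _ _).comp ((W0Submodule Ω s p).subtypeL.comp
    (W0.ofPair Ω s p).symm.toContinuousLinearEquiv.toContinuousLinearMap)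

/-- The class of the difference quotient of an element of `W^{s,p}_0(Ω)`. -/
def W0.sndL (Ω : Set (RN N)) (s p : ℝ) [Fact (1 < p)] :
    W0 Ω s p →L[ℝ] Lp ℝ (ENNReal.ofReal p) (volume : Measure (RN N × RN N)) :=
  (WithLp.sndL 1 ℝ _ _).comp ((W0Submodule Ω s p).subtypeL.comp
    (W0.ofPair Ω s p).symm.toContinuousLinearEquiv.toContinuousLinearMap)

theorem W0.norm_eq (w : W0 Ω s p) : ‖w‖ = ‖W0.fstL Ω s p w‖ + ‖W0.sndL Ω s p w‖ := by
  rw [← (W0.ofPair Ω s p).symm.norm_map w]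
  exact WithLp.prod_norm_eq_of_L1 ((W0.ofPair Ω s p).symm w).1

theorem W0.fstL_toW0 {f : RN N → ℝ} (hf : MemW0 Ω s p f) :
    W0.fstL Ω s p (toW0 Ω s p f) = hf.memLp.toLp f := by
  rw [toW0, dif_pos hf]; rfl

theorem W0.sndL_toW0 {f : RN N → ℝ} (hf : MemW0 Ω s p f) :
    W0.sndL Ω s p (toW0 Ω s p f) = hf.memLp_diffQuot.toLp (diffQuot s p f) := by
  rw [toW0, dif_pos hf]; rfl

theorem W0.ext {v w : W0 Ω s p} (h₁ : W0.fstL Ω s p v = W0.fstL Ω s p w)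
    (h₂ : W0.sndL Ω s p v = W0.sndL Ω s p w) : v = w := by
  rw [← sub_eq_zero, ← norm_eq_zero, W0.norm_eq, map_sub, map_sub, h₁, h₂]
  simp

theorem toW0_of_not_memW0 {f : RN N → ℝ} (hf : ¬ MemW0 Ω s p f) : toW0 Ω s p f = 0 := by
  rw [toW0, dif_neg hf]

theorem toW0_sub {f g : RN N → ℝ} (hf : MemW0 Ω s p f) (hg : MemW0 Ω s p g) :
    toW0 Ω s p (f - g) = toW0 Ω s p f - toW0 Ω s p g := by
  refine W0.ext ?_ ?_
  · rw [map_sub, W0.fstL_toW0 hf, W0.fstL_toW0 hg, W0.fstL_toW0 (hf.sub hg), ← MemLp.toLp_sub]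
  · rw [map_sub, W0.sndL_toW0 hf, W0.sndL_toW0 hg, W0.sndL_toW0 (hf.sub hg), ← MemLp.toLp_sub]
    exact MemLp.toLp_congr _ _ (by rw [diffQuot_sub])

theorem toW0_zero : toW0 Ω s p (0 : RN N → ℝ) = 0 := by
  have h := MemW0.zero Ω s p
  simpa using toW0_sub h h

theorem toW0_smul (c : ℝ) (f : RN N → ℝ) : toW0 Ω s p (c • f) = c • toW0 Ω s p f := by
  rcases eq_or_ne c 0 with rfl | hc
  · rw [zero_smul, zero_smul, toW0_zero]
  by_cases hf : MemW0 Ω s p f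
  · refine W0.ext ?_ ?_
    · rw [map_smul, W0.fstL_toW0 hf, W0.fstL_toW0 (hf.smul c), ← MemLp.toLp_const_smul]
    · rw [map_smul, W0.sndL_toW0 hf, W0.sndL_toW0 (hf.smul c), ← MemLp.toLp_const_smul]
      exact MemLp.toLp_congr _ _ (by rw [diffQuot_smul])
  · rw [toW0_of_not_memW0 hf, toW0_of_not_memW0 fun h => hf (h.of_smul hc), smul_zero]

theorem norm_toW0_sub {f g : RN N → ℝ} (hf : MemW0 Ω s p f) (hg : MemW0 Ω s p g) :
    ‖toW0 Ω s p f - toW0 Ω s p g‖ = (eLpNorm (f - g) (ENNReal.ofReal p) volume).toReal +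
      (eLpNorm (diffQuot s p f - diffQuot s p g) (ENNReal.ofReal p) volume).toReal := by
  rw [W0.norm_eq, map_sub, map_sub, W0.fstL_toW0 hf, W0.fstL_toW0 hg, W0.sndL_toW0 hf,
    W0.sndL_toW0 hg, ← MemLp.toLp_sub, ← MemLp.toLp_sub, Lp.norm_toLp, Lp.norm_toLp]

theorem tendsto_toW0 {f : ℕ → RN N → ℝ} {g : RN N → ℝ} (hf : ∀ n, MemW0 Ω s p (f n))
    (hg : MemW0 Ω s p g)
    (h₁ : Tendsto (fun n => eLpNorm (f n - g) (ENNReal.ofReal p) volume) atTop (𝓝 0))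
    (h₂ : Tendsto (fun n => eLpNorm (diffQuot s p (f n) - diffQuot s p g) (ENNReal.ofReal p) volume)
      atTop (𝓝 0)) :
    Tendsto (fun n => toW0 Ω s p (f n)) atTop (𝓝 (toW0 Ω s p g)) := by
  rw [tendsto_iff_norm_sub_tendsto_zero]
  simp_rw [norm_toW0_sub (hf _) hg]
  simpa using ((ENNReal.tendsto_toReal ENNReal.zero_ne_top).comp h₁).add
    ((ENNReal.tendsto_toReal ENNReal.zero_ne_top).comp h₂)

theorem tendsto_eLpNorm_of_tendsto_toW0 {f : ℕ → RN N → ℝ} {g : RN N → ℝ}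
    (hf : ∀ n, MemW0 Ω s p (f n)) (hg : MemW0 Ω s p g)
    (h : Tendsto (fun n => toW0 Ω s p (f n)) atTop (𝓝 (toW0 Ω s p g))) :
    Tendsto (fun n => eLpNorm (f n - g) (ENNReal.ofReal p) volume) atTop (𝓝 0) ∧
    Tendsto (fun n => eLpNorm (diffQuot s p (f n) - diffQuot s p g) (ENNReal.ofReal p) volume)
      atTop (𝓝 0) := by
  constructor
  · have := ((W0.fstL Ω s p).continuous.tendsto _).comp h
    simp only [Function.comp_def, W0.fstL_toW0 (hf _), W0.fstL_toW0 hg] at this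
    exact (Lp.tendsto_Lp_iff_tendsto_eLpNorm'' _ _ _ _).mp this
  · have := ((W0.sndL Ω s p).continuous.tendsto _).comp h
    simp only [Function.comp_def, W0.sndL_toW0 (hf _), W0.sndL_toW0 hg] at this
    exact (Lp.tendsto_Lp_iff_tendsto_eLpNorm'' _ _ _ _).mp this

instance secondCountableTopologyW0 : SecondCountableTopology (W0 Ω s p) := by
  have h1 : SecondCountableTopology (Lp ℝ (ENNReal.ofReal p) (volume : Measure (RN N))) :=
    inferInstance
  have h0 : IsSeparable (volume : Measure (RN N × RN N)) :=
    instIsSeparableOfCountablyGeneratedOfSFinite _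
  have h2 : SecondCountableTopology
      (Lp ℝ (ENNReal.ofReal p) (volume : Measure (RN N × RN N))) := Lp.SecondCountableTopology
  have h3 : SecondCountableTopology (WithLp 1 (Lp ℝ (ENNReal.ofReal p) (volume : Measure (RN N)) ×
      Lp ℝ (ENNReal.ofReal p) (volume : Measure (RN N × RN N)))) :=
    WithLp.secondCountableTopology _ _ _
  exact inferInstanceAs (SecondCountableTopology (W0Submodule Ω s p))

end FractionalSobolevBasics

/-! ### Density of test functions in `W^{s,p}_0(Ω) ∩ L^2(Ω)` -/

section TestFunctionDensity

variable {N : ℕ} {Ω : Set (RN N)} {s p : ℝ}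

theorem norm_diffQuot_comp_le (s p : ℝ) {θ : ℝ → ℝ} (hθ : ∀ a b, |θ a - θ b| ≤ |a - b|)
    (f : RN N → ℝ) (z : RN N × RN N) : ‖diffQuot s p (θ ∘ f) z‖ ≤ ‖diffQuot s p f z‖ := by
  simp only [diffQuot, norm_div, Function.comp_apply, Real.norm_eq_abs]
  exact div_le_div_of_nonneg_right (hθ _ _) (abs_nonneg _)

theorem aestronglyMeasurable_diffQuot (s p : ℝ) {f : RN N → ℝ}
    (hf : AEStronglyMeasurable f volume) : AEStronglyMeasurable (diffQuot s p f) volume := by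
  have h1 : AEStronglyMeasurable (fun z : RN N × RN N => f z.1) volume := hf.comp_fst
  have h2 : AEStronglyMeasurable (fun z : RN N × RN N => f z.2) volume := hf.comp_snd
  have h3 : AEMeasurable (fun z : RN N × RN N => ‖z.1 - z.2‖ ^ ((N : ℝ) / p + s)) volume := by
    fun_prop
  exact ((h1.sub h2).aemeasurable.div h3).aestronglyMeasurable

theorem MemW0.comp {f : RN N → ℝ} (hf : MemW0 Ω s p f) {θ : ℝ → ℝ} (hθ0 : θ 0 = 0)
    (hθ : ∀ a b, |θ a - θ b| ≤ |a - b|) (hθc : Continuous θ) : MemW0 Ω s p (θ ∘ f) := by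
  have hm : AEStronglyMeasurable (θ ∘ f) volume := hθc.comp_aestronglyMeasurable hf.memLp.1
  refine ⟨hf.memLp.mono hm (ae_of_all _ fun x => ?_), hf.memLp_diffQuot.mono
    (aestronglyMeasurable_diffQuot s p hm)
    (ae_of_all _ fun z => norm_diffQuot_comp_le s p hθ f z), ?_⟩
  · simpa [hθ0] using hθ (f x) 0
  · filter_upwards [hf.vanish] with x hx hxΩ
    simp [hx hxΩ, hθ0]

theorem ae_tendsto_diffQuot (s p : ℝ) {f : ℕ → RN N → ℝ} {g : RN N → ℝ}
    (h : ∀ᵐ x, Tendsto (fun n => f n x) atTop (𝓝 (g x))) :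
    ∀ᵐ z, Tendsto (fun n => diffQuot s p (f n) z) atTop (𝓝 (diffQuot s p g z)) := by
  filter_upwards [Measure.quasiMeasurePreserving_fst.ae h,
    Measure.quasiMeasurePreserving_snd.ae h] with z h1 h2
  exact (h1.sub h2).div_const _

theorem IsTestFun.comp {ψ : RN N → ℝ} (hψ : IsTestFun Ω ψ) {θ : ℝ → ℝ} (hθ : ContDiff ℝ ∞ θ)
    (hθ0 : θ 0 = 0) : IsTestFun Ω (θ ∘ ψ) :=
  ⟨hθ.comp hψ.smooth, hψ.compact.comp_left hθ0,
    (closure_mono (Function.support_comp_subset hθ0 ψ)).trans hψ.supp⟩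

theorem isTestFun_zero : IsTestFun Ω (0 : RN N → ℝ) :=
  ⟨contDiff_const, HasCompactSupport.zero, by simp [tsupport]⟩

variable [Fact (1 < p)]

/-- The dominating sequence may vary with `n`, so that truncated approximations are controlled by
the untruncated ones. Both parts of the norm are dominated separately. -/
theorem tendsto_toW0_of_ae {f g : ℕ → RN N → ℝ} {F G : RN N → ℝ}
    (hf : ∀ n, MemW0 Ω s p (f n)) (hF : MemW0 Ω s p F)
    (hfF : Tendsto (fun n => toW0 Ω s p (f n)) atTop (𝓝 (toW0 Ω s p F)))
    (hg : ∀ n, MemW0 Ω s p (g n)) (hG : MemW0 Ω s p G)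
    (hle : ∀ n x, ‖g n x‖ ≤ ‖f n x‖)
    (hle' : ∀ n z, ‖diffQuot s p (g n) z‖ ≤ ‖diffQuot s p (f n) z‖)
    (hae : ∀ᵐ x, Tendsto (fun n => g n x) atTop (𝓝 (G x))) :
    Tendsto (fun n => toW0 Ω s p (g n)) atTop (𝓝 (toW0 Ω s p G)) := by
  obtain ⟨h1, h2⟩ := tendsto_eLpNorm_of_tendsto_toW0 hf hF hfF
  have hp : 1 ≤ ENNReal.ofReal p := Fact.out
  exact tendsto_toW0 hg hG
    (tendsto_eLpNorm_sub_of_dominated hp ENNReal.ofReal_ne_top (fun n => (hf n).memLp) hF.memLp h1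
      (fun n => (hg n).memLp.1) hG.memLp hle hae)
    (tendsto_eLpNorm_sub_of_dominated hp ENNReal.ofReal_ne_top (fun n => (hf n).memLp_diffQuot)
      hF.memLp_diffQuot h2 (fun n => (hg n).memLp_diffQuot.1) hG.memLp_diffQuot hle'
      (ae_tendsto_diffQuot s p hae))

/-- Test functions that belong to `W^{s,p}_0(Ω)` are dense in it. -/
theorem TestFunDense.exists_seq (hdense : TestFunDense Ω s p) (f : RN N → ℝ) :
    ∃ ψ : ℕ → RN N → ℝ, (∀ n, IsTestFun Ω (ψ n)) ∧
      (∀ n, MemW0 Ω s p (ψ n)) ∧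
      Tendsto (fun n => toW0 Ω s p (ψ n)) atTop (𝓝 (toW0 Ω s p f)) := by
  obtain ⟨w, hw, hlim⟩ := mem_closure_iff_seq_limit.mp (hdense (toW0 Ω s p f))
  have : ∀ n, ∃ ψ : RN N → ℝ, IsTestFun Ω ψ ∧ MemW0 Ω s p ψ ∧ toW0 Ω s p ψ = w n := by
    intro n
    obtain ⟨ψ, h1, h2⟩ := hw n
    -- By its default value `toW0` sends a function outside the space to `0`; such a `ψ` is replaced
    -- by the zero function.
    by_cases hm : MemW0 Ω s p ψ
    · exact ⟨ψ, h1, hm, h2⟩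
    · exact ⟨0, isTestFun_zero, MemW0.zero Ω s p, by
        rw [toW0_zero, ← h2, toW0_of_not_memW0 hm]⟩
  choose ψ h1 h2 h3 using this
  exact ⟨ψ, h1, h2, by simpa only [h3] using hlim⟩

/-- A function in `W^{s,p}_0(Ω) ∩ L^2(Ω)` is approximated by test functions in both norms at
once. -/
theorem TestFunDense.exists_near (hdense : TestFunDense Ω s p)
    (hΩb : Bornology.IsBounded Ω) {f : RN N → ℝ} (hf : MemW0 Ω s p f)
    (hf2 : MemLp f 2 (volume.restrict Ω)) {ε : ℝ} (hε : 0 < ε) :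
    ∃ ψ : RN N → ℝ, IsTestFun Ω ψ ∧ MemW0 Ω s p ψ ∧ MemLp ψ 2 (volume.restrict Ω) ∧
      ‖toW0 Ω s p ψ - toW0 Ω s p f‖ < ε ∧
      eLpNorm (ψ - f) 2 (volume.restrict Ω) < ENNReal.ofReal ε := by
  have hfin : IsFiniteMeasure (volume.restrict Ω) := ⟨by
    simpa using hΩb.measure_lt_top⟩
  have hθ : ∀ n (h : RN N → ℝ), MemW0 Ω s p h → MemW0 Ω s p (smoothTrunc n ∘ h) := fun n h hh =>
    hh.comp (smoothTrunc_zero n) (abs_smoothTrunc_sub_le n) (contDiff_smoothTrunc n).continuous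
  have hθ2 : ∀ n (h : RN N → ℝ), AEStronglyMeasurable h volume →
      MemLp (smoothTrunc n ∘ h) 2 (volume.restrict Ω) := fun n h hh =>
    MemLp.of_bound ((contDiff_smoothTrunc n).continuous.comp_aestronglyMeasurable hh).restrict
      ((n + 1) * (Real.pi / 2)) (ae_of_all _ fun x => abs_smoothTrunc_le n (h x))
  -- First stage: truncations of `f` tend to `f` in both norms, dominated by `f` itself.
  have ha : Tendsto (fun n => toW0 Ω s p (smoothTrunc n ∘ f)) atTop (𝓝 (toW0 Ω s p f)) :=
    tendsto_toW0_of_ae (fun _ => hf) hf tendsto_const_nhds (fun n => hθ n f hf) hf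
      (fun n x => abs_smoothTrunc_le_abs n (f x))
      (fun n z => norm_diffQuot_comp_le s p (abs_smoothTrunc_sub_le n) f z)
      (ae_of_all _ fun x => tendsto_smoothTrunc (f x))
  have hb : Tendsto (fun n => eLpNorm (smoothTrunc n ∘ f - f) 2 (volume.restrict Ω)) atTop
      (𝓝 0) :=
    tendsto_eLpNorm_sub_of_dominated (by norm_num) (by simp) (fun _ => hf2) hf2 (by simp)
      (fun n => (hθ2 n f hf.memLp.1).1) hf2 (fun n x => abs_smoothTrunc_le_abs n (f x))
      (ae_of_all _ fun x => tendsto_smoothTrunc (f x))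
  have hε2 : 0 < ε / 2 := half_pos hε
  obtain ⟨n, hn1, hn2⟩ := ((ha.eventually (Metric.ball_mem_nhds _ hε2)).and
    (hb.eventually (gt_mem_nhds (ENNReal.ofReal_pos.mpr hε2)))).exists
  obtain ⟨ψ, hψ, hψW, hψlim⟩ := hdense.exists_seq f
  have hp : ENNReal.ofReal p ≠ 0 := (zero_lt_one.trans_le (Fact.out : 1 ≤ ENNReal.ofReal p)).ne'
  -- Second stage, at a fixed level `n`: along an almost everywhere convergent subsequence, the
  -- truncated test functions are dominated by the untruncated ones in `W^{s,p}_0(Ω)`, and in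
  -- `L^2(Ω)` by the constant bound of the truncation.
  obtain ⟨ns, hns, hae⟩ := (tendstoInMeasure_of_tendsto_eLpNorm hp (fun k => (hψW k).memLp.1)
    hf.memLp.1 (tendsto_eLpNorm_of_tendsto_toW0 hψW hf hψlim).1).exists_seq_tendsto_ae
  have hae' : ∀ᵐ x, Tendsto (fun k => (smoothTrunc n ∘ ψ (ns k)) x) atTop
      (𝓝 ((smoothTrunc n ∘ f) x)) := by
    filter_upwards [hae] with x hx
    exact ((contDiff_smoothTrunc n).continuous.tendsto _).comp hx
  have hc : Tendsto (fun k => toW0 Ω s p (smoothTrunc n ∘ ψ (ns k))) atTop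
      (𝓝 (toW0 Ω s p (smoothTrunc n ∘ f))) :=
    tendsto_toW0_of_ae (fun k => hψW (ns k)) hf (hψlim.comp hns.tendsto_atTop)
      (fun k => hθ n _ (hψW _)) (hθ n f hf) (fun k x => abs_smoothTrunc_le_abs n _)
      (fun k z => norm_diffQuot_comp_le s p (abs_smoothTrunc_sub_le n) _ z) hae'
  have hconst : MemLp (fun _ : RN N => ((n : ℝ) + 1) * (Real.pi / 2)) 2 (volume.restrict Ω) :=
    memLp_const _
  have hd : Tendsto (fun k => eLpNorm (smoothTrunc n ∘ ψ (ns k) - smoothTrunc n ∘ f) 2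
      (volume.restrict Ω)) atTop (𝓝 0) :=
    tendsto_eLpNorm_sub_of_dominated (by norm_num) (by simp) (fun _ => hconst) hconst (by simp)
      (fun k => (hθ2 n _ (hψW _).memLp.1).1) (hθ2 n f hf.memLp.1)
      (fun k x => (abs_smoothTrunc_le n _).trans (le_abs_self _)) (ae_restrict_of_ae hae')
  obtain ⟨k, hk1, hk2⟩ := ((hc.eventually (Metric.ball_mem_nhds _ hε2)).and
    (hd.eventually (gt_mem_nhds (ENNReal.ofReal_pos.mpr hε2)))).exists
  rw [dist_eq_norm] at hn1 hk1
  refine ⟨smoothTrunc n ∘ ψ (ns k), (hψ _).comp (contDiff_smoothTrunc n) (smoothTrunc_zero n),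
    hθ n _ (hψW _), hθ2 n _ (hψW _).memLp.1, ?_, ?_⟩
  · refine (norm_sub_le_norm_sub_add_norm_sub _ (toW0 Ω s p (smoothTrunc n ∘ f)) _).trans_lt ?_
    linarith
  · have e : smoothTrunc n ∘ ψ (ns k) - f = (smoothTrunc n ∘ ψ (ns k) - smoothTrunc n ∘ f) +
        (smoothTrunc n ∘ f - f) := by abel
    rw [e]
    refine (eLpNorm_add_le ((hθ2 n _ (hψW _).memLp.1).1.sub (hθ2 n f hf.memLp.1).1)
      ((hθ2 n f hf.memLp.1).1.sub hf2.1) (by norm_num)).trans_lt ?_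
    refine (ENNReal.add_lt_add hk2 hn2).trans_eq ?_
    rw [← ENNReal.ofReal_add hε2.le hε2.le, add_halves]

end TestFunctionDensity

/-! ### The nonlinearity `|a|^(p-2) a` on `L^p` -/

section PowerNonlinearity

/-- The derivative `|a|^(p-2) a` of `|a|^p / p`. -/
def powDeriv (p a : ℝ) : ℝ := |a| ^ (p - 2) * a

theorem hasDerivAt_abs_rpow_div {p : ℝ} (hp : 1 < p) (a : ℝ) :
    HasDerivAt (fun x : ℝ => (1 / p) * |x| ^ p) (powDeriv p a) a := by
  have h := (hasDerivAt_abs_rpow a hp).const_mul (1 / p)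
  have hp0 : p ≠ 0 := by positivity
  have e : 1 / p * (p * |a| ^ (p - 2) * a) = powDeriv p a := by
    unfold powDeriv; field_simp
  rwa [e] at h

theorem abs_powDeriv {p : ℝ} (hp : 1 < p) (a : ℝ) : |powDeriv p a| = |a| ^ (p - 1) := by
  rcases eq_or_ne a 0 with rfl | ha
  · simp [powDeriv, Real.zero_rpow (sub_pos.mpr hp).ne']
  · have ha' : 0 < |a| := abs_pos.mpr ha
    rw [powDeriv, abs_mul, abs_of_nonneg (Real.rpow_nonneg ha'.le _), ← Real.rpow_add_one ha'.ne']
    congr 1; ring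

theorem powDeriv_mul_self {p : ℝ} (hp : 1 < p) (a : ℝ) : powDeriv p a * a = |a| ^ p := by
  rcases eq_or_ne a 0 with rfl | ha
  · simp [powDeriv, Real.zero_rpow (zero_lt_one.trans hp).ne']
  · have ha' : 0 < |a| := abs_pos.mpr ha
    rw [powDeriv, mul_assoc, ← abs_mul_abs_self a, ← mul_assoc, ← Real.rpow_add_one ha'.ne',
      ← Real.rpow_add_one ha'.ne']
    congr 1; ring

theorem powDeriv_mul_le {p : ℝ} (hp : 1 < p) (a b : ℝ) :
    |powDeriv p a * b| ≤ (1 - 1 / p) * |a| ^ p + 1 / p * |b| ^ p := by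
  have hpq := Real.HolderConjugate.conjExponent hp
  have h := Real.young_inequality_of_nonneg (Real.rpow_nonneg (abs_nonneg a) (p - 1))
    (abs_nonneg b) hpq.symm
  rw [abs_mul, abs_powDeriv hp]
  have e1 : (|a| ^ (p - 1)) ^ p.conjExponent = |a| ^ p := by
    rw [← Real.rpow_mul (abs_nonneg a), Real.conjExponent, mul_div_cancel₀ _ (sub_pos.mpr hp).ne']
  have e2 : 1 - 1 / p = 1 / p.conjExponent := by
    rw [Real.conjExponent]; field_simp
  rw [e1] at h
  rw [e2]
  linarith [h, div_eq_mul_one_div (|a| ^ p) p.conjExponent, div_eq_mul_one_div (|b| ^ p) p,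
    mul_comm (|a| ^ p) (1 / p.conjExponent), mul_comm (|b| ^ p) (1 / p)]

/-- The tangent inequality of the convex function `|x|^p / p`; it is Young's inequality once
`powDeriv p a * a = |a|^p` is subtracted. -/
theorem powDeriv_mul_sub_le {p : ℝ} (hp : 1 < p) (a b : ℝ) :
    powDeriv p a * (b - a) ≤ 1 / p * |b| ^ p - 1 / p * |a| ^ p := by
  have h := (le_abs_self _).trans (powDeriv_mul_le hp a b)
  rw [mul_sub, powDeriv_mul_self hp]
  linarith

/-- For `p < 2` the factor `|a|^(p-2)` is singular at `0`, but the product has modulus `|a|^(p-1)`,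
which tends to `0`. -/
theorem continuous_powDeriv {p : ℝ} (hp : 1 < p) : Continuous (powDeriv p) := by
  rw [continuous_iff_continuousAt]
  intro a
  rcases eq_or_ne a 0 with rfl | ha
  · have h0 : powDeriv p 0 = 0 := by simp [powDeriv]
    rw [ContinuousAt, h0, tendsto_zero_iff_abs_tendsto_zero]
    have : Continuous fun x : ℝ => |x| ^ (p - 1) :=
      continuous_abs.rpow_const fun _ => Or.inr (sub_pos.mpr hp).le
    have h1 := this.tendsto 0
    simp only [abs_zero, Real.zero_rpow (sub_pos.mpr hp).ne'] at h1
    exact h1.congr fun x => (abs_powDeriv hp x).symm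
  · exact (continuousAt_id.abs.rpow_const (Or.inl (abs_ne_zero.mpr ha))).mul continuousAt_id

variable {α : Type*} {m : MeasurableSpace α} {μ : Measure α} {p : ℝ}

theorem MeasureTheory.MemLp.integrable_abs_rpow (hp : 1 < p) {F : α → ℝ}
    (hF : MemLp F (ENNReal.ofReal p) μ) : Integrable (fun x => |F x| ^ p) μ := by
  have := hF.integrable_norm_rpow (ENNReal.ofReal_pos.mpr (by linarith)).ne' ENNReal.ofReal_ne_top
  rwa [ENNReal.toReal_ofReal (by linarith)] at this

theorem aestronglyMeasurable_powDeriv (hp : 1 < p) {F : α → ℝ} (hF : AEStronglyMeasurable F μ) :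
    AEStronglyMeasurable (fun x => powDeriv p (F x)) μ :=
  (continuous_powDeriv hp).comp_aestronglyMeasurable hF

theorem memLp_powDeriv (hp : 1 < p) {F : α → ℝ} (hF : MemLp F (ENNReal.ofReal p) μ) :
    MemLp (fun x => powDeriv p (F x)) (ENNReal.ofReal (p / (p - 1))) μ := by
  have h := hF.norm_rpow_div (ENNReal.ofReal (p - 1))
  rw [← ENNReal.ofReal_div_of_pos (sub_pos.mpr hp), ENNReal.toReal_ofReal (sub_pos.mpr hp).le] at h
  refine h.congr_norm (aestronglyMeasurable_powDeriv hp hF.1) (ae_of_all _ fun x => ?_)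
  rw [Real.norm_eq_abs (powDeriv p (F x)), abs_powDeriv hp, Real.norm_of_nonneg]
  · rfl
  · positivity

theorem integrable_powDeriv_mul (hp : 1 < p) {F k : α → ℝ} (hF : MemLp F (ENNReal.ofReal p) μ)
    (hk : MemLp k (ENNReal.ofReal p) μ) : Integrable (fun x => powDeriv p (F x) * k x) μ :=
  (((hF.integrable_abs_rpow hp).const_mul (1 - 1 / p)).add
    ((hk.integrable_abs_rpow hp).const_mul (1 / p))).mono'
    ((aestronglyMeasurable_powDeriv hp hF.1).mul hk.1)
    (ae_of_all _ fun x => powDeriv_mul_le hp (F x) (k x))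

theorem exists_dual_powDeriv [Fact (1 < p)] {F : α → ℝ} (hF : MemLp F (ENNReal.ofReal p) μ) :
    ∃ A : StrongDual ℝ (Lp ℝ (ENNReal.ofReal p) μ),
      ∀ k : Lp ℝ (ENNReal.ofReal p) μ, A k = ∫ x, powDeriv p (F x) * k x ∂μ := by
  have hp : 1 < p := Fact.out
  have hpq : p.HolderConjugate (p / (p - 1)) := Real.HolderConjugate.conjExponent hp
  have : Fact (1 ≤ ENNReal.ofReal (p / (p - 1))) :=
    ⟨ENNReal.one_le_ofReal.mpr hpq.symm.lt.le⟩
  have := hpq.symm.ennrealOfReal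
  have hJ := memLp_powDeriv hp hF
  refine ⟨(ContinuousLinearMap.mul ℝ ℝ).lpPairing μ (ENNReal.ofReal (p / (p - 1)))
    (ENNReal.ofReal p) (hJ.toLp _), fun k => ?_⟩
  rw [ContinuousLinearMap.lpPairing_eq_integral]
  refine integral_congr_ae ?_
  filter_upwards [hJ.coeFn_toLp] with x hx
  simp [hx]

theorem integral_abs_rpow_eq [Fact (1 < p)] (F : Lp ℝ (ENNReal.ofReal p) μ) :
    ∫ x, |F x| ^ p ∂μ = ‖F‖ ^ p := by
  have hp : 1 < p := Fact.out
  have hp0 : 0 < p := by linarith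
  rw [Lp.norm_def, (Lp.memLp F).eLpNorm_eq_integral_rpow_norm (ENNReal.ofReal_pos.mpr hp0).ne'
    ENNReal.ofReal_ne_top, ENNReal.toReal_ofReal hp0.le, ENNReal.toReal_ofReal (by positivity),
    ← Real.rpow_mul (by positivity), inv_mul_cancel₀ hp0.ne', Real.rpow_one]
  rfl

/-- By convexity the slope with step at most `1` lies between the derivative at `0` and the slope
with step `1`, which supplies the dominating function. The lemma exhibits the first variation as a
limit of expressions in `L^p` norms, hence its measurability in time. -/
theorem tendsto_slope_integral_abs_rpow [Fact (1 < p)] {F k : α → ℝ}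
    (hF : MemLp F (ENNReal.ofReal p) μ) (hk : MemLp k (ENNReal.ofReal p) μ) :
    Tendsto (fun n : ℕ => ((n : ℝ) + 1) * ((1 / p) * ∫ x, |F x + 1 / ((n : ℝ) + 1) * k x| ^ p ∂μ -
      (1 / p) * ∫ x, |F x| ^ p ∂μ)) atTop (𝓝 (∫ x, powDeriv p (F x) * k x ∂μ)) := by
  have hp : 1 < p := Fact.out
  have hF1 := hF.integrable_abs_rpow hp
  have hFk : ∀ c : ℝ, MemLp (fun x => F x + c * k x) (ENNReal.ofReal p) μ := fun c =>
    hF.add (hk.const_mul c)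
  have hFk1 := fun c => (hFk c).integrable_abs_rpow hp
  have e : ∀ n : ℕ, ((n : ℝ) + 1) * ((1 / p) * ∫ x, |F x + 1 / ((n : ℝ) + 1) * k x| ^ p ∂μ -
      (1 / p) * ∫ x, |F x| ^ p ∂μ) = ∫ x, ((n : ℝ) + 1) * (1 / p *
        |F x + 1 / ((n : ℝ) + 1) * k x| ^ p - 1 / p * |F x| ^ p) ∂μ := fun n => by
    rw [integral_const_mul, integral_sub ((hFk1 _).const_mul _) (hF1.const_mul _),
      integral_const_mul, integral_const_mul]
  simp_rw [e]
  refine tendsto_integral_of_dominated_convergence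
    (fun x => |powDeriv p (F x) * k x| + |1 / p * |F x + 1 * k x| ^ p - 1 / p * |F x| ^ p|)
    ?_ ?_ ?_ ?_
  · exact fun n => ((((hFk1 _).const_mul _).sub (hF1.const_mul _)).const_mul _).1
  · exact (integrable_powDeriv_mul hp hF hk).abs.add
      (((hFk1 1).const_mul (1 / p)).sub (hF1.const_mul (1 / p))).abs
  · refine fun n => ae_of_all _ fun x => ?_
    have hn : (0 : ℝ) < (n : ℝ) + 1 := by positivity
    set ε : ℝ := 1 / ((n : ℝ) + 1) with hε
    have hεpos : 0 < ε := by positivity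
    have hε1 : ε ≤ 1 := by
      rw [hε, div_le_one hn]; linarith [(n.cast_nonneg : (0 : ℝ) ≤ n)]
    have hnε : ((n : ℝ) + 1) * ε = 1 := by rw [hε]; field_simp
    set c := F x + ε * k x with hc
    have lo := powDeriv_mul_sub_le hp (F x) c
    have up1 := powDeriv_mul_sub_le hp c (F x)
    have up2 := powDeriv_mul_sub_le hp c (F x + 1 * k x)
    have lo' : powDeriv p (F x) * k x ≤
        ((n : ℝ) + 1) * (1 / p * |c| ^ p - 1 / p * |F x| ^ p) := by
      have := mul_le_mul_of_nonneg_left lo hn.le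
      have e1 : ((n : ℝ) + 1) * (powDeriv p (F x) * (c - F x)) = powDeriv p (F x) * k x := by
        rw [hc]; linear_combination powDeriv p (F x) * k x * hnε
      linarith
    have up : ((n : ℝ) + 1) * (1 / p * |c| ^ p - 1 / p * |F x| ^ p) ≤
        1 / p * |F x + 1 * k x| ^ p - 1 / p * |F x| ^ p := by
      have h1 := mul_le_mul_of_nonneg_left up1 (sub_nonneg.mpr hε1)
      have h2 := mul_le_mul_of_nonneg_left up2 hεpos.le
      -- `c` is the convex combination of `F x` and `F x + k x` with weights `1 - ε` and `ε`, so the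
      -- two tangent terms at `c` cancel.
      have e1 : (1 - ε) * (powDeriv p c * (F x - c)) +
          ε * (powDeriv p c * (F x + 1 * k x - c)) = 0 := by
        rw [hc]; ring
      have h3 : 1 / p * |c| ^ p - 1 / p * |F x| ^ p ≤
          ε * (1 / p * |F x + 1 * k x| ^ p - 1 / p * |F x| ^ p) := by linarith
      refine (mul_le_mul_of_nonneg_left h3 hn.le).trans_eq ?_
      rw [← mul_assoc, hnε, one_mul]
    rw [Real.norm_eq_abs]
    refine abs_le.mpr ⟨?_, ?_⟩
    · linarith [neg_abs_le (powDeriv p (F x) * k x),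
        abs_nonneg (1 / p * |F x + 1 * k x| ^ p - 1 / p * |F x| ^ p)]
    · linarith [abs_nonneg (powDeriv p (F x) * k x),
        le_abs_self (1 / p * |F x + 1 * k x| ^ p - 1 / p * |F x| ^ p)]
  · refine ae_of_all _ fun x => ?_
    have h1 : HasDerivAt (fun y : ℝ => F x + y * k x) (k x) 0 := by
      simpa using ((hasDerivAt_id (0 : ℝ)).mul_const (k x)).const_add (F x)
    have h2 : HasDerivAt (fun y : ℝ => 1 / p * |F x + y * k x| ^ p) (powDeriv p (F x) * k x) 0 := by
      have h0 : HasDerivAt (fun x : ℝ => (1 / p) * |x| ^ p) (powDeriv p (F x)) (F x + 0 * k x) := by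
        simpa using hasDerivAt_abs_rpow_div hp (F x)
      exact HasDerivAt.comp (h₂ := fun x : ℝ => (1 / p) * |x| ^ p) (0 : ℝ) h0 h1
    have hs := hasDerivAt_iff_tendsto_slope_zero.mp h2
    have hy : Tendsto (fun n : ℕ => 1 / ((n : ℝ) + 1)) atTop (𝓝[≠] 0) :=
      tendsto_nhdsWithin_iff.mpr ⟨tendsto_one_div_add_atTop_nhds_zero_nat,
        Eventually.of_forall fun n => by simp only [mem_compl_iff, mem_singleton_iff]; positivity⟩
    refine (hs.comp hy).congr fun n => ?_
    simp

/-- The pairing of `|F t|^(p-2) F t` with a fixed function is a measurable function of `t`. -/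
theorem aestronglyMeasurable_integral_powDeriv [Fact (1 < p)] {ν : Measure ℝ}
    {F : ℝ → Lp ℝ (ENNReal.ofReal p) μ} (hF : AEStronglyMeasurable F ν)
    (k : Lp ℝ (ENNReal.ofReal p) μ) :
    AEStronglyMeasurable (fun t => ∫ x, powDeriv p (F t x) * k x ∂μ) ν := by
  have hp : 1 < p := Fact.out
  refine aestronglyMeasurable_of_tendsto_ae atTop (fun n => ?_) (ae_of_all _ fun t =>
    tendsto_slope_integral_abs_rpow (Lp.memLp (F t)) (Lp.memLp k))
  -- As powers of norms, the integrals are continuous in `F t`; no representative jointly measurable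
  -- in `(t, x)` is needed.
  have e : ∀ t, ∫ x, |F t x + 1 / ((n : ℝ) + 1) * k x| ^ p ∂μ =
      ‖F t + (1 / ((n : ℝ) + 1)) • k‖ ^ p := fun t => by
    rw [← integral_abs_rpow_eq]
    refine integral_congr_ae ?_
    filter_upwards [Lp.coeFn_add (F t) ((1 / ((n : ℝ) + 1)) • k),
      Lp.coeFn_smul (1 / ((n : ℝ) + 1)) k] with x h1 h2
    rw [h1, Pi.add_apply, h2]
    rfl
  simp_rw [e, integral_abs_rpow_eq]
  have hc : Continuous fun G : Lp ℝ (ENNReal.ofReal p) μ => ‖G‖ ^ p :=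
    continuous_norm.rpow_const fun _ => Or.inr (by linarith)
  have h1 := hc.comp_aestronglyMeasurable (hF.add_const ((1 / ((n : ℝ) + 1)) • k))
  have h2 := hc.comp_aestronglyMeasurable hF
  exact ((h1.const_mul _).sub (h2.const_mul _)).const_mul _

end PowerNonlinearity

/-! ### The weak equation at almost every time -/

section WeakFormulation

variable {N : ℕ} {Ω : Set (RN N)} {s p : ℝ}

theorem fracH_div_eq (hp : 1 < p) (f : RN N → ℝ) (z : RN N × RN N) :
    fracH s p z.1 z.2 (f z.1 - f z.2) / ‖z.1 - z.2‖ ^ (N : ℝ) =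
      1 / p * |diffQuot s p f z| ^ p := by
  have hp0 : p ≠ 0 := by positivity
  rcases eq_or_ne z.1 z.2 with h | h
  · simp [fracH, diffQuot, h, Real.zero_rpow hp0]
  · have hr : 0 < ‖z.1 - z.2‖ := norm_pos_iff.mpr (sub_ne_zero.mpr h)
    rw [fracH, diffQuot, abs_div, abs_of_nonneg (Real.rpow_nonneg hr.le ((N : ℝ) / p + s)),
      Real.div_rpow (abs_nonneg _) (Real.rpow_nonneg hr.le _),
      Real.div_rpow (abs_nonneg _) (Real.rpow_nonneg hr.le _), ← Real.rpow_mul hr.le,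
      ← Real.rpow_mul hr.le, mul_div_assoc, div_div, ← Real.rpow_add hr]
    congr 4
    field_simp
    ring

theorem deriv_fracH (hp : 1 < p) (x y : RN N) (ξ : ℝ) :
    deriv (fracH s p x y) ξ = powDeriv p (ξ / ‖x - y‖ ^ s) / ‖x - y‖ ^ s := by
  have hc : 0 ≤ ‖x - y‖ ^ s := Real.rpow_nonneg (norm_nonneg _) _
  have e : fracH s p x y = fun ξ => 1 / p * |ξ / ‖x - y‖ ^ s| ^ p := by
    funext ξ
    rw [fracH, abs_div, abs_of_nonneg hc]
  rw [e, div_eq_mul_one_div (powDeriv p _)]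
  exact (HasDerivAt.comp (h₂ := fun x : ℝ => (1 / p) * |x| ^ p) ξ
    (hasDerivAt_abs_rpow_div hp _) ((hasDerivAt_id ξ).div_const _)).deriv

/-- With `d = |x - y|^(N/p)`, the weight `|x - y|^N` is `d^p`: one factor `d` goes to the test
function and `d^(p-1)` into `powDeriv`, homogeneous of degree `p - 1`. On the diagonal both sides
vanish. -/
theorem deriv_fracH_mul_div_eq (hp : 1 < p) (f φ : RN N → ℝ) (z : RN N × RN N) :
    deriv (fracH s p z.1 z.2) (f z.1 - f z.2) * (φ z.1 - φ z.2) / ‖z.1 - z.2‖ ^ (N : ℝ) =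
      powDeriv p (diffQuot s p f z) * diffQuot s p φ z := by
  have hp0 : p ≠ 0 := by positivity
  rw [deriv_fracH hp]
  rcases eq_or_ne z.1 z.2 with h | h
  · simp [diffQuot, h]
  · have hr : 0 < ‖z.1 - z.2‖ := norm_pos_iff.mpr (sub_ne_zero.mpr h)
    set r := ‖z.1 - z.2‖
    have hc : 0 < r ^ s := Real.rpow_pos_of_pos hr _
    have hd : 0 < r ^ ((N : ℝ) / p) := Real.rpow_pos_of_pos hr _
    have hN : r ^ (N : ℝ) =
        (r ^ ((N : ℝ) / p)) ^ (p - 2) * r ^ ((N : ℝ) / p) * r ^ ((N : ℝ) / p) := by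
      rw [← Real.rpow_add_one hd.ne', ← Real.rpow_add_one hd.ne', ← Real.rpow_mul hr.le]
      congr 1
      field_simp
      ring
    have hd2 : 0 < (r ^ ((N : ℝ) / p)) ^ (p - 2) := Real.rpow_pos_of_pos hd _
    simp only [diffQuot]
    change _ = powDeriv p ((f z.1 - f z.2) / r ^ ((N : ℝ) / p + s)) *
      ((φ z.1 - φ z.2) / r ^ ((N : ℝ) / p + s))
    rw [Real.rpow_add hr, hN]
    generalize r ^ ((N : ℝ) / p) = d at hd hd2
    generalize r ^ s = c at hc
    generalize f z.1 - f z.2 = ξ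
    generalize φ z.1 - φ z.2 = δ
    have e : ξ / (d * c) = ξ / c / d := by field_simp
    have e2 : |ξ / c / d| ^ (p - 2) = |ξ / c| ^ (p - 2) / d ^ (p - 2) := by
      rw [abs_div _ d, abs_of_pos hd, Real.div_rpow (abs_nonneg _) hd.le]
    rw [e, powDeriv, powDeriv, e2]
    field_simp

theorem IsTestFun.spaceTime {T : ℝ} {ψ : RN N → ℝ} (hψ : IsTestFun Ω ψ) {η : ℝ → ℝ}
    (hη : ContDiff ℝ ∞ η) (hηs : HasCompactSupport η) (hηT : tsupport η ⊆ Ioo 0 T) :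
    IsSpaceTimeTestFun Ω T (fun t x => η t * ψ x) := by
  have hsub : tsupport (fun q : ℝ × RN N => η q.1 * ψ q.2) ⊆ tsupport η ×ˢ tsupport ψ := by
    refine closure_minimal (fun q hq => ?_) ((isClosed_tsupport η).prod (isClosed_tsupport ψ))
    rw [Function.mem_support, mul_ne_zero_iff] at hq
    exact ⟨subset_tsupport η hq.1, subset_tsupport ψ hq.2⟩
  exact ⟨(hη.comp contDiff_fst).mul (hψ.smooth.comp contDiff_snd),
    (hηs.isCompact.prod hψ.compact.isCompact).of_isClosed_subset (isClosed_tsupport _) hsub,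
    hsub.trans (prod_mono hηT hψ.supp)⟩

theorem integrable_mul_of_contDiff_compactSupport {η b : ℝ → ℝ} {ν : Measure ℝ}
    (hη : ContDiff ℝ ∞ η) (hηs : HasCompactSupport η) (hb : Integrable b ν) :
    Integrable (fun t => η t * b t) ν := by
  obtain ⟨C, hC⟩ := hηs.exists_bound_of_continuous hη.continuous
  exact hb.bdd_mul hη.continuous.aestronglyMeasurable (ae_of_all _ hC)

variable [Fact (1 < p)]

/-- `powDeriv` maps `L^p` into `L^{p'}`, so by Hölder the first variation at a fixed time is a
bounded functional, determined by its values on a dense set. -/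
theorem exists_dual_diffQuot {f : RN N → ℝ}
    (hf : MemLp (diffQuot s p f) (ENNReal.ofReal p) volume) :
    ∃ A : StrongDual ℝ (W0 Ω s p), ∀ φ, MemW0 Ω s p φ →
      A (toW0 Ω s p φ) = ∫ z, powDeriv p (diffQuot s p f z) * diffQuot s p φ z := by
  obtain ⟨A, hA⟩ := exists_dual_powDeriv hf
  refine ⟨A.comp (W0.sndL Ω s p), fun φ hφ => ?_⟩
  rw [ContinuousLinearMap.comp_apply, W0.sndL_toW0 hφ, hA]
  refine integral_congr_ae ?_
  filter_upwards [hφ.memLp_diffQuot.coeFn_toLp] with z hz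
  rw [hz]

theorem MemLpW0.memLp_sndL {T : ℝ} {u : ℝ → RN N → ℝ} (hu : MemLpW0 Ω s p T u) :
    MemLp (fun t => W0.sndL Ω s p (toW0 Ω s p (u t))) (ENNReal.ofReal p)
      (volume.restrict (Ioo 0 T)) :=
  (W0.sndL Ω s p).comp_memLp' hu.memLp

theorem MemLpW0.integrable_rpow_sndL {T : ℝ} {u : ℝ → RN N → ℝ} (hu : MemLpW0 Ω s p T u) :
    Integrable (fun t => ‖W0.sndL Ω s p (toW0 Ω s p (u t))‖ ^ p) (volume.restrict (Ioo 0 T)) := by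
  have hp : 1 < p := Fact.out
  simpa using hu.memLp_sndL.norm.integrable_abs_rpow hp

theorem integrable_integral_powDeriv_diffQuot {T : ℝ} {u : ℝ → RN N → ℝ}
    (hu : MemLpW0 univ s p T u) {ψ : RN N → ℝ}
    (hψ : MemLp (diffQuot s p ψ) (ENNReal.ofReal p) volume) :
    Integrable (fun t => ∫ z, powDeriv p (diffQuot s p (u t) z) * diffQuot s p ψ z)
      (volume.restrict (Ioo 0 T)) := by
  have hp : 1 < p := Fact.out
  have hm := aestronglyMeasurable_integral_powDeriv hu.memLp_sndL.1 (hψ.toLp _)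
  have e : ∀ᵐ t ∂(volume.restrict (Ioo 0 T)),
      ∫ z, powDeriv p (W0.sndL univ s p (toW0 univ s p (u t)) z) * (hψ.toLp _) z =
        ∫ z, powDeriv p (diffQuot s p (u t) z) * diffQuot s p ψ z := by
    filter_upwards [hu.mem] with t ht
    refine integral_congr_ae ?_
    rw [W0.sndL_toW0 ht]
    filter_upwards [ht.memLp_diffQuot.coeFn_toLp, hψ.coeFn_toLp] with z h1 h2
    rw [h1, h2]
  refine Integrable.congr ?_ e
  -- Young's inequality separates the energy of `u t`, integrable in time, from the fixed
  -- contribution of `ψ`.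
  refine ((hu.integrable_rpow_sndL.const_mul (1 - 1 / p)).add
    (integrable_const (1 / p * ‖hψ.toLp _‖ ^ p))).mono' hm (ae_of_all _ fun t => ?_)
  have h1 := (Lp.memLp (W0.sndL univ s p (toW0 univ s p (u t)))).integrable_abs_rpow hp
  have h2 := (Lp.memLp (hψ.toLp _)).integrable_abs_rpow hp
  simp only [Pi.add_apply]
  rw [← integral_abs_rpow_eq, ← integral_abs_rpow_eq, ← integral_const_mul, ← integral_const_mul,
    ← integral_add (h1.const_mul _) (h2.const_mul _)]
  refine norm_integral_le_of_norm_le ((h1.const_mul _).add (h2.const_mul _))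
    (ae_of_all _ fun z => powDeriv_mul_le hp _ _)

/-- The weak formulation holds at almost every time, for all functions in `W^{s,p}_0(Ω)`. -/
theorem ae_weak_formulation {T : ℝ} {u : ℝ → RN N → ℝ}
    {g : ℝ → StrongDual ℝ (W0 Ω s p)} (hdense : TestFunDense Ω s p)
    (hu : MemLpW0 univ s p T u) (hg : Integrable g (volume.restrict (Ioo 0 T)))
    (hweak : ∀ φ : ℝ → RN N → ℝ, IsSpaceTimeTestFun Ω T φ →
      (∫ t in Ioo 0 T, ∫ z : RN N × RN N,
          deriv (fracH s p z.1 z.2) (u t z.1 - u t z.2) * (φ t z.1 - φ t z.2)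
            / ‖z.1 - z.2‖ ^ (N : ℝ))
        + ∫ t in Ioo 0 T, g t (toW0 Ω s p (φ t)) = 0) :
    ∀ᵐ t ∂(volume.restrict (Ioo 0 T)), ∀ f, MemW0 Ω s p f →
      (∫ z, powDeriv p (diffQuot s p (u t) z) * diffQuot s p f z) + g t (toW0 Ω s p f) = 0 := by
  have hp : 1 < p := Fact.out
  have hgi : ∀ w : W0 Ω s p, Integrable (fun t => g t w) (volume.restrict (Ioo 0 T)) := fun w =>
    (ContinuousLinearMap.apply ℝ ℝ w : StrongDual ℝ (W0 Ω s p) →L[ℝ] ℝ).integrable_comp hg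
  have step : ∀ ψ, IsTestFun Ω ψ → MemW0 Ω s p ψ → ∀ᵐ t ∂(volume.restrict (Ioo 0 T)),
      (∫ z, powDeriv p (diffQuot s p (u t) z) * diffQuot s p ψ z) + g t (toW0 Ω s p ψ) = 0 := by
    intro ψ hψ hψW
    have hA := integrable_integral_powDeriv_diffQuot hu hψW.memLp_diffQuot
    rw [ae_restrict_iff' measurableSet_Ioo]
    -- For fixed `ψ`, the products `η t * ψ x` are admissible in the weak equation, and `η` is
    -- arbitrary.
    refine isOpen_Ioo.ae_eq_zero_of_integral_contDiff_smul_eq_zero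
      (IntegrableOn.locallyIntegrableOn (hA.add (hgi (toW0 Ω s p ψ)))) ?_
    intro η hη hηs hηT
    rw [← setIntegral_eq_integral_of_forall_compl_eq_zero (s := Ioo 0 T)
      (fun x hx => by simp [image_eq_zero_of_notMem_tsupport fun h => hx (hηT h)])]
    simp only [smul_eq_mul, mul_add]
    rw [integral_add (integrable_mul_of_contDiff_compactSupport hη hηs hA)
      (integrable_mul_of_contDiff_compactSupport hη hηs (hgi _))]
    refine Eq.trans ?_ (hweak _ (hψ.spaceTime hη hηs hηT))
    congr 1
    · refine integral_congr_ae (ae_of_all _ fun t => ?_)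
      change η t * _ = _
      rw [← integral_const_mul]
      refine integral_congr_ae (ae_of_all _ fun z => ?_)
      have := deriv_fracH_mul_div_eq (s := s) hp (u t) (η t • ψ) z
      rw [diffQuot_smul] at this
      simp only [Pi.smul_apply, smul_eq_mul] at this
      simp only [this]
      ring
    · refine integral_congr_ae (ae_of_all _ fun t => ?_)
      change η t * _ = g t (toW0 Ω s p (η t • ψ))
      rw [toW0_smul, map_smul, smul_eq_mul]
  obtain ⟨D, hDsub, hDc, hD⟩ := hdense.exists_countable_dense_subset
  -- A countable dense set of classes gives one null set for all of them. Every representing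
  -- functional `A` is allowed, since one is known to exist only at times where `u t` lies in the
  -- space.
  have hall : ∀ᵐ t ∂(volume.restrict (Ioo 0 T)), ∀ w ∈ D, ∀ A : StrongDual ℝ (W0 Ω s p),
      (∀ φ, MemW0 Ω s p φ →
        A (toW0 Ω s p φ) = ∫ z, powDeriv p (diffQuot s p (u t) z) * diffQuot s p φ z) →
      A w + g t w = 0 := by
    rw [ae_ball_iff hDc]
    intro w hw
    obtain ⟨ψ, hψ, rfl⟩ := hDsub hw
    by_cases hψW : MemW0 Ω s p ψ
    · filter_upwards [step ψ hψ hψW] with t ht A hA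
      rw [hA ψ hψW, ht]
    · exact ae_of_all _ fun t A _ => by rw [toW0_of_not_memW0 hψW]; simp
  filter_upwards [hall, hu.mem] with t ht hut f hf
  obtain ⟨A, hA⟩ := exists_dual_diffQuot (Ω := Ω) hut.memLp_diffQuot
  rw [← hA f hf]
  have := Continuous.ext_on hD (A + g t).continuous (continuous_const (y := (0 : ℝ)))
    fun w hw => ht w hw A hA
  exact congrFun this (toW0 Ω s p f)

end WeakFormulation

/-! ### Square-integrable functions on a product as curves in `L^2` -/

section Slices

/-- A map to a second countable metric space is measurable if its distances to all points are. -/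
theorem measurable_of_measurable_edist {α X : Type*} [MeasurableSpace α] [PseudoEMetricSpace X]
    [SecondCountableTopology X] [MeasurableSpace X] [BorelSpace X] {f : α → X}
    (h : ∀ c : X, Measurable fun a => edist (f a) c) : Measurable f := by
  refine measurable_of_isOpen fun U hU => ?_
  have : ∀ x : U, ∃ r : ℝ≥0∞, 0 < r ∧ Metric.eball (x : X) r ⊆ U := fun x => by
    simpa using EMetric.isOpen_iff.mp hU x x.2
  choose r hr hrU using this
  obtain ⟨S, hS, hSU⟩ := TopologicalSpace.isOpen_iUnion_countable
    (fun x : U => Metric.eball (x : X) (r x)) fun x => Metric.isOpen_eball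
  have hU' : U = ⋃ x ∈ S, Metric.eball (x : X) (r x) := by
    rw [hSU]
    exact Subset.antisymm (fun y hy => mem_iUnion.mpr ⟨⟨y, hy⟩, Metric.mem_eball_self (hr _)⟩)
      (iUnion_subset hrU)
  rw [hU', preimage_iUnion₂]
  exact MeasurableSet.biUnion hS fun x _ => measurableSet_lt (h x) measurable_const

variable {X : Type*} [MeasurableSpace X]

open Classical in
/-- The class in `L^2` of a function; it is used only for square-integrable functions. -/
def toL2 (μ : Measure X) (f : X → ℝ) : Lp ℝ 2 μ :=
  if h : MemLp f 2 μ then h.toLp f else 0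

variable {μ : Measure X}

theorem toL2_eq {f : X → ℝ} (hf : MemLp f 2 μ) : toL2 μ f = hf.toLp f := dif_pos hf

theorem coeFn_toL2 {f : X → ℝ} (hf : MemLp f 2 μ) : toL2 μ f =ᵐ[μ] f := by
  rw [toL2_eq hf]; exact hf.coeFn_toLp

theorem toL2_sub {f g : X → ℝ} (hf : MemLp f 2 μ) (hg : MemLp g 2 μ) :
    toL2 μ (f - g) = toL2 μ f - toL2 μ g := by
  rw [toL2_eq hf, toL2_eq hg, toL2_eq (hf.sub hg), MemLp.toLp_sub]

theorem toL2_congr {f g : X → ℝ} (h : f =ᵐ[μ] g) : toL2 μ f = toL2 μ g := by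
  by_cases hf : MemLp f 2 μ
  · rw [toL2_eq hf, toL2_eq ((memLp_congr_ae h).mp hf)]
    exact MemLp.toLp_congr _ _ h
  · rw [toL2, toL2, dif_neg hf, dif_neg fun hg => hf ((memLp_congr_ae h).mpr hg)]

theorem inner_toL2 {f g : X → ℝ} (hf : MemLp f 2 μ) (hg : MemLp g 2 μ) :
    inner ℝ (toL2 μ f) (toL2 μ g) = ∫ x, f x * g x ∂μ := by
  rw [L2.inner_def]
  refine integral_congr_ae ?_
  filter_upwards [coeFn_toL2 hf, coeFn_toL2 hg] with x h1 h2
  simp [h1, h2, mul_comm]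

theorem edist_toL2 {f : X → ℝ} (hf : MemLp f 2 μ) (c : Lp ℝ 2 μ) :
    edist (toL2 μ f) c = eLpNorm (fun x => f x - c x) 2 μ := by
  rw [Lp.edist_def]
  refine eLpNorm_congr_ae ?_
  filter_upwards [coeFn_toL2 hf] with x hx
  simp [hx]

theorem eLpNorm_two_eq (f : X → ℝ) : eLpNorm f 2 μ = (∫⁻ x, ‖f x‖ₑ ^ (2 : ℝ) ∂μ) ^ (1 / 2 : ℝ) := by
  rw [eLpNorm_eq_lintegral_rpow_enorm_toReal (by simp) (by simp)]
  simp

/-- The target is separable, so it is enough that distances to fixed elements are measurable in `t`,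
and those are integrals of Tonelli type. -/
theorem measurable_toL2_slice [SFinite μ] [IsSeparable μ] {f : ℝ × X → ℝ} (hf : Measurable f) :
    StronglyMeasurable fun t => toL2 μ fun x => f (t, x) := by
  have : Fact ((2 : ℝ≥0∞) ≠ ⊤) := ⟨by simp⟩
  let _ : MeasurableSpace (Lp ℝ 2 μ) := borel _
  have : BorelSpace (Lp ℝ 2 μ) := ⟨rfl⟩
  refine Measurable.stronglyMeasurable (measurable_of_measurable_edist fun c => ?_)
  obtain ⟨c', hc', hcc'⟩ : ∃ c' : X → ℝ, Measurable c' ∧ c =ᵐ[μ] c' :=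
    ⟨_, (Lp.aestronglyMeasurable c).aemeasurable.measurable_mk,
      (Lp.aestronglyMeasurable c).aemeasurable.ae_eq_mk⟩
  have hm : ∀ k : X → ℝ, Measurable k →
      Measurable fun t => eLpNorm (fun x => f (t, x) - k x) 2 μ := fun k hk => by
    simp_rw [eLpNorm_two_eq]
    refine Measurable.pow_const (Measurable.lintegral_prod_right'
      (f := fun q : ℝ × X => ‖f q - k q.2‖ₑ ^ (2 : ℝ)) ?_) _
    fun_prop
  have hm0 : Measurable fun t => eLpNorm (fun x => f (t, x)) 2 μ := by
    simpa using hm (fun _ => 0) measurable_const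
  classical
  -- Off `S` the slice is not square-integrable and `toL2` takes its default value `0`.
  let S : Set ℝ := {t | eLpNorm (fun x => f (t, x)) 2 μ < ⊤}
  have hS : MeasurableSet S :=
    measurableSet_lt hm0 measurable_const
  have hmem : ∀ t, MemLp (fun x => f (t, x)) 2 μ ↔ t ∈ S := fun t =>
    ⟨fun h => h.2, fun h => ⟨(hf.comp measurable_prodMk_left).aestronglyMeasurable, h⟩⟩
  have e : (fun t => edist (toL2 μ fun x => f (t, x)) c) =
      S.piecewise (fun t => eLpNorm (fun x => f (t, x) - c' x) 2 μ) (fun _ => edist 0 c) := by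
    funext t
    by_cases ht : MemLp (fun x => f (t, x)) 2 μ
    · rw [piecewise_eq_of_mem _ _ _ ((hmem t).mp ht), edist_toL2 ht]
      refine eLpNorm_congr_ae ?_
      filter_upwards [hcc'] with x hx
      rw [hx]
    · rw [piecewise_eq_of_notMem _ _ _ fun h => ht ((hmem t).mpr h), toL2, dif_neg ht]
  rw [e]
  exact Measurable.piecewise hS (hm c' hc') measurable_const

/-- A square-integrable function on a product is a square-integrable curve in `L^2`. -/
theorem memLp_toL2_slice [SFinite μ] [IsSeparable μ] {ν : Measure ℝ} [SFinite ν] {f : ℝ × X → ℝ}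
    (hf : MemLp f 2 (ν.prod μ)) :
    (∀ᵐ t ∂ν, MemLp (fun x => f (t, x)) 2 μ) ∧
      MemLp (fun t => toL2 μ fun x => f (t, x)) 2 ν := by
  have hlt : ∫⁻ t, ∫⁻ x, ‖f (t, x)‖ₑ ^ (2 : ℝ) ∂μ ∂ν < ⊤ := by
    rw [← lintegral_prod _ (hf.1.enorm.pow_const _)]
    have := lintegral_rpow_enorm_lt_top_of_eLpNorm_lt_top (p := 2) (by simp) (by simp) hf.2
    simpa using this
  have hae : ∀ᵐ t ∂ν, MemLp (fun x => f (t, x)) 2 μ := by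
    filter_upwards [ae_lt_top' (hf.1.enorm.pow_const (2 : ℝ)).lintegral_prod_right' hlt.ne,
      hf.1.prodMk_left] with t h1 h2
    refine ⟨h2, ?_⟩
    rw [eLpNorm_two_eq]
    exact ENNReal.rpow_lt_top_of_nonneg (by norm_num) h1.ne
  refine ⟨hae, ?_, ?_⟩
  · refine ⟨_, measurable_toL2_slice hf.1.aemeasurable.measurable_mk, ?_⟩
    filter_upwards [Measure.ae_ae_of_ae_prod hf.1.aemeasurable.ae_eq_mk] with t ht
    exact toL2_congr ht
  · rw [eLpNorm_eq_lintegral_rpow_enorm_toReal (by simp) (by simp)]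
    refine ENNReal.rpow_lt_top_of_nonneg (by norm_num) ?_
    refine ne_top_of_le_ne_top hlt.ne (lintegral_mono_ae ?_)
    filter_upwards [hae] with t ht
    have : ‖toL2 μ fun x => f (t, x)‖ₑ = eLpNorm (fun x => f (t, x)) 2 μ := by
      rw [toL2_eq ht, Lp.enorm_toLp]
    rw [this, eLpNorm_two_eq, ENNReal.toReal_ofNat, ← ENNReal.rpow_mul]
    norm_num

theorem MemCL2.continuousOn {N : ℕ} {Ω : Set (RN N)} {T : ℝ} {u : ℝ → RN N → ℝ}
    (hu : MemCL2 Ω T u) : ContinuousOn (fun t => toL2 (volume.restrict Ω) (u t)) (Icc 0 T) := by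
  intro t₀ ht₀
  rw [ContinuousWithinAt, tendsto_iff_edist_tendsto_0]
  refine (hu.cont t₀ ht₀).congr' ?_
  filter_upwards [self_mem_nhdsWithin] with t ht
  rw [toL2_eq (hu.mem t ht), toL2_eq (hu.mem t₀ ht₀), Lp.edist_toLp_toLp]

end Slices

/-! ### Time increments tested with functions of space -/

section Evolution

variable {N : ℕ} {Ω : Set (RN N)} {s p : ℝ} [Fact (1 < p)]

theorem integral_mul_inner_eq {T : ℝ} {u : ℝ → RN N → ℝ}
    (hu : ∀ᵐ t ∂(volume.restrict (Ioo 0 T)), MemLp (u t) 2 (volume.restrict Ω)) {ψ : RN N → ℝ}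
    (hψ : MemLp ψ 2 (volume.restrict Ω)) (η : ℝ → ℝ) :
    ∫ t in Ioo 0 T, η t * inner ℝ (toL2 (volume.restrict Ω) (u t)) (toL2 (volume.restrict Ω) ψ) =
      ∫ t in Ioo 0 T, ∫ x in Ω, u t x * (η t * ψ x) := by
  refine integral_congr_ae ?_
  filter_upwards [hu] with t ht
  rw [inner_toL2 ht hψ, ← integral_const_mul]
  refine integral_congr_ae (ae_of_all _ fun x => ?_)
  change η t * (u t x * ψ x) = u t x * (η t * ψ x)
  ring

theorem MemCL2.ae_memLp {T : ℝ} {u : ℝ → RN N → ℝ} (hu : MemCL2 Ω T u) :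
    ∀ᵐ t ∂(volume.restrict (Ioo 0 T)), MemLp (u t) 2 (volume.restrict Ω) := by
  filter_upwards [ae_restrict_mem measurableSet_Ioo] with t ht
    using hu.mem t (Ioo_subset_Icc_self ht)

/-- Increments in time of the difference of two curves with a time derivative in
`L^2(Ω_T)` and in `L^{p'}(0,T; W^{s,p}_0(Ω)^*)`, tested with a function of space. -/
theorem inner_sub_eq_integral_of_testFun {T : ℝ} (hT : 0 < T) {u v w : ℝ → RN N → ℝ}
    {g : ℝ → StrongDual ℝ (W0 Ω s p)} (hu : MemCL2 Ω T u) (hv : MemCL2 Ω T v)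
    (hug : HasDualTimeDeriv Ω s p T u g) (hvw : HasL2TimeDeriv Ω T v w)
    (hg : Integrable g (volume.restrict (Ioo 0 T))) {ψ : RN N → ℝ} (hψ : IsTestFun Ω ψ)
    (hψ2 : MemLp ψ 2 (volume.restrict Ω)) {t₁ t₂ : ℝ} (ht₁ : t₁ ∈ Icc 0 T) (ht₂ : t₂ ∈ Icc 0 T) :
    inner ℝ ((toL2 (volume.restrict Ω) (v t₂) - toL2 (volume.restrict Ω) (u t₂)) -
      (toL2 (volume.restrict Ω) (v t₁) - toL2 (volume.restrict Ω) (u t₁)))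
        (toL2 (volume.restrict Ω) ψ) =
      ∫ r in t₁..t₂, (inner ℝ (toL2 (volume.restrict Ω) (w r)) (toL2 (volume.restrict Ω) ψ) -
        g r (toW0 Ω s p ψ)) := by
  obtain ⟨hw1, hw2⟩ := memLp_toL2_slice hvw.memLp
  set U := fun t => toL2 (volume.restrict Ω) (u t) with hU
  set V := fun t => toL2 (volume.restrict Ω) (v t) with hV
  set W := fun t => toL2 (volume.restrict Ω) (w t) with hW
  set k := toL2 (volume.restrict Ω) ψ with hk
  have hUc : ContinuousOn U (Icc 0 T) := hu.continuousOn
  have hVc : ContinuousOn V (Icc 0 T) := hv.continuousOn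
  have hWi : Integrable W (volume.restrict (Ioo 0 T)) := hw2.integrable (by norm_num)
  have hbw : Integrable (fun t => inner ℝ (W t) k) (volume.restrict (Ioo 0 T)) :=
    hWi.inner_const k
  have hbg : Integrable (fun t => g t (toW0 Ω s p ψ)) (volume.restrict (Ioo 0 T)) :=
    (ContinuousLinearMap.apply ℝ ℝ (toW0 Ω s p ψ) :
      StrongDual ℝ (W0 Ω s p) →L[ℝ] ℝ).integrable_comp hg
  have hUk : ContinuousOn (fun t => inner ℝ (U t) k) (Icc 0 T) := hUc.inner continuousOn_const
  have hVk : ContinuousOn (fun t => inner ℝ (V t) k) (Icc 0 T) := hVc.inner continuousOn_const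
  -- For fixed `ψ` the problem is scalar: testing both distributional derivatives with `η t * ψ x`
  -- identifies the weak derivative of the continuous function `(V t - U t, ψ)`.
  have main := sub_eq_integral_of_weak_deriv hT (a := fun t => inner ℝ (V t) k - inner ℝ (U t) k)
    (b := fun t => inner ℝ (W t) k - g t (toW0 Ω s p ψ)) (hVk.sub hUk) (hbw.sub hbg) ?_ ht₁ ht₂
  · rw [← main]
    change inner ℝ ((V t₂ - U t₂) - (V t₁ - U t₁)) k = _
    simp only [inner_sub_left]
  intro η hη hηs hηT
  have hφ := hψ.spaceTime hη hηs hηT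
  have hd : ∀ t x, deriv (fun r => η r * ψ x) t = deriv η t * ψ x := fun t x =>
    deriv_mul_const (hη.differentiable (by simp) t) (ψ x)
  have e1 := hug.deriv_eq _ hφ
  have e2 := hvw.deriv_eq _ hφ
  simp only [hd] at e1 e2
  rw [← integral_mul_inner_eq hu.ae_memLp hψ2] at e1
  rw [← integral_mul_inner_eq hv.ae_memLp hψ2, ← integral_mul_inner_eq hw1 hψ2] at e2
  have e3 : ∀ t, g t (toW0 Ω s p fun x => η t * ψ x) = η t * g t (toW0 Ω s p ψ) := fun t => by
    change g t (toW0 Ω s p (η t • ψ)) = _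
    rw [toW0_smul, map_smul, smul_eq_mul]
  simp only [e3] at e1
  have hη' : Continuous (deriv η) := hη.continuous_deriv (by simp)
  have i1 : ∀ f : ℝ → ℝ, ContinuousOn f (Icc 0 T) →
      IntegrableOn (fun t => deriv η t * f t) (Ioo 0 T) := fun f hf =>
    ((hη'.continuousOn.mul hf).integrableOn_Icc).mono_set Ioo_subset_Icc_self
  simp only [mul_sub]
  rw [integral_sub (integrable_mul_of_contDiff_compactSupport hη hηs hbw)
    (integrable_mul_of_contDiff_compactSupport hη hηs hbg), integral_sub (i1 _ hVk) (i1 _ hUk),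
    e1, e2]
  ring

/-- Increments in time tested with a function in `W^{s,p}_0(Ω) ∩ L^2(Ω)`. -/
theorem inner_sub_eq_integral {T : ℝ} (hT : 0 < T) {u v w : ℝ → RN N → ℝ}
    {g : ℝ → StrongDual ℝ (W0 Ω s p)} (hdense : TestFunDense Ω s p)
    (hΩb : Bornology.IsBounded Ω) (hu : MemCL2 Ω T u) (hv : MemCL2 Ω T v)
    (hug : HasDualTimeDeriv Ω s p T u g) (hvw : HasL2TimeDeriv Ω T v w)
    (hg : Integrable g (volume.restrict (Ioo 0 T))) {f : RN N → ℝ} (hf : MemW0 Ω s p f)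
    (hf2 : MemLp f 2 (volume.restrict Ω)) {t₁ t₂ : ℝ} (ht₁ : t₁ ∈ Icc 0 T) (ht₂ : t₂ ∈ Icc 0 T) :
    inner ℝ ((toL2 (volume.restrict Ω) (v t₂) - toL2 (volume.restrict Ω) (u t₂)) -
      (toL2 (volume.restrict Ω) (v t₁) - toL2 (volume.restrict Ω) (u t₁)))
        (toL2 (volume.restrict Ω) f) =
      ∫ r in t₁..t₂, (inner ℝ (toL2 (volume.restrict Ω) (w r)) (toL2 (volume.restrict Ω) f) -
        g r (toW0 Ω s p f)) := by
  obtain ⟨hw1, hw2⟩ := memLp_toL2_slice hvw.memLp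
  have hWi : Integrable (fun t => toL2 (volume.restrict Ω) (w t)) (volume.restrict (Ioo 0 T)) :=
    hw2.integrable (by norm_num)
  have hsub : ∀ {E : Type} [NormedAddCommGroup E] {h : ℝ → E},
      Integrable h (volume.restrict (Ioo 0 T)) →
      IntervalIntegrable h volume t₁ t₂ := fun {E} _ h hh => by
    have : IntervalIntegrable h volume 0 T := by
      rwa [intervalIntegrable_iff_integrableOn_Ioo_of_le hT.le]
    exact this.mono_set (by rw [uIcc_of_le hT.le]; exact uIcc_subset_Icc ht₁ ht₂)
  -- Pulling `x` and `y` out of the Bochner integrals shows that the right side is continuous in the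
  -- two classes, each in its own norm.
  have repr : ∀ (x : Lp ℝ 2 (volume.restrict Ω)) (y : W0 Ω s p),
      ∫ r in t₁..t₂, (inner ℝ (toL2 (volume.restrict Ω) (w r)) x - g r y) =
        inner ℝ (∫ r in t₁..t₂, toL2 (volume.restrict Ω) (w r)) x - (∫ r in t₁..t₂, g r) y := by
    intro x y
    have c1 := (innerSL ℝ x).intervalIntegral_comp_comm (hsub hWi)
    have c2 := (ContinuousLinearMap.apply ℝ ℝ y :
      StrongDual ℝ (W0 Ω s p) →L[ℝ] ℝ).intervalIntegral_comp_comm (hsub hg)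
    simp only [innerSL_apply_apply, ContinuousLinearMap.apply_apply] at c1 c2
    rw [intervalIntegral.integral_sub, c2, real_inner_comm, ← c1]
    · simp only [real_inner_comm]
    · exact hsub (hWi.inner_const x)
    · exact hsub ((ContinuousLinearMap.apply ℝ ℝ y :
        StrongDual ℝ (W0 Ω s p) →L[ℝ] ℝ).integrable_comp hg)
  have near : ∀ n : ℕ, ∃ ψ : RN N → ℝ, IsTestFun Ω ψ ∧ MemLp ψ 2 (volume.restrict Ω) ∧
      ‖toW0 Ω s p ψ - toW0 Ω s p f‖ ≤ 1 / ((n : ℝ) + 1) ∧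
      ‖toL2 (volume.restrict Ω) ψ - toL2 (volume.restrict Ω) f‖ ≤ 1 / ((n : ℝ) + 1) := by
    intro n
    have hn : 0 < 1 / ((n : ℝ) + 1) := by positivity
    obtain ⟨ψ, h1, -, h3, h4, h5⟩ := hdense.exists_near hΩb hf hf2 hn
    refine ⟨ψ, h1, h3, h4.le, ?_⟩
    rw [← toL2_sub h3 hf2, toL2_eq (h3.sub hf2), Lp.norm_toLp]
    exact ENNReal.toReal_le_of_le_ofReal hn.le h5.le
  choose ψ h1 h2 h3 h4 using near
  have l1 : Tendsto (fun n => toW0 Ω s p (ψ n)) atTop (𝓝 (toW0 Ω s p f)) :=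
    tendsto_iff_norm_sub_tendsto_zero.mpr (squeeze_zero (fun _ => norm_nonneg _) h3
      tendsto_one_div_add_atTop_nhds_zero_nat)
  have l2 : Tendsto (fun n => toL2 (volume.restrict Ω) (ψ n)) atTop
      (𝓝 (toL2 (volume.restrict Ω) f)) :=
    tendsto_iff_norm_sub_tendsto_zero.mpr (squeeze_zero (fun _ => norm_nonneg _) h4
      tendsto_one_div_add_atTop_nhds_zero_nat)
  refine tendsto_nhds_unique (tendsto_const_nhds.inner l2) ?_
  simp_rw [inner_sub_eq_integral_of_testFun hT hu hv hug hvw hg (h1 _) (h2 _) ht₁ ht₂, repr]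
  exact (tendsto_const_nhds.inner l2).sub ((ContinuousLinearMap.continuous _).tendsto _ |>.comp l1)

end Evolution

/-! ### Convexity of the energy and the variational inequality -/

section VariationalInequality

variable {N : ℕ} {Ω : Set (RN N)} {s p : ℝ} [Fact (1 < p)]

theorem integral_fracH_div_eq {f : RN N → ℝ} (hf : MemW0 univ s p f) :
    ∫ z : RN N × RN N, fracH s p z.1 z.2 (f z.1 - f z.2) / ‖z.1 - z.2‖ ^ (N : ℝ) =
      1 / p * ‖W0.sndL univ s p (toW0 univ s p f)‖ ^ p := by
  have hp : 1 < p := Fact.out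
  simp_rw [fracH_div_eq hp]
  rw [integral_const_mul, ← integral_abs_rpow_eq, W0.sndL_toW0 hf]
  congr 1
  refine integral_congr_ae ?_
  filter_upwards [hf.memLp_diffQuot.coeFn_toLp] with z hz
  rw [hz]

theorem integrable_fracH_div {f : RN N → ℝ} (hf : MemW0 univ s p f) :
    Integrable fun z : RN N × RN N =>
      fracH s p z.1 z.2 (f z.1 - f z.2) / ‖z.1 - z.2‖ ^ (N : ℝ) := by
  have hp : 1 < p := Fact.out
  simp_rw [fracH_div_eq hp]
  exact (hf.memLp_diffQuot.integrable_abs_rpow hp).const_mul _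

theorem MemLpW0.integrable_integral_fracH {T : ℝ} {u : ℝ → RN N → ℝ} (hu : MemLpW0 univ s p T u) :
    Integrable (fun t => ∫ z : RN N × RN N,
      fracH s p z.1 z.2 (u t z.1 - u t z.2) / ‖z.1 - z.2‖ ^ (N : ℝ))
      (volume.restrict (Ioo 0 T)) := by
  refine (hu.integrable_rpow_sndL.const_mul (1 / p)).congr ?_
  filter_upwards [hu.mem] with t ht
  rw [integral_fracH_div_eq ht]

theorem integral_fracH_sub_div {f h : RN N → ℝ} (hf : MemW0 univ s p f) (hh : MemW0 univ s p h) :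
    ∫ z : RN N × RN N, (fracH s p z.1 z.2 (f z.1 - f z.2) - fracH s p z.1 z.2 (h z.1 - h z.2)) /
        ‖z.1 - z.2‖ ^ (N : ℝ) =
      (∫ z : RN N × RN N, fracH s p z.1 z.2 (f z.1 - f z.2) / ‖z.1 - z.2‖ ^ (N : ℝ)) -
        ∫ z : RN N × RN N, fracH s p z.1 z.2 (h z.1 - h z.2) / ‖z.1 - z.2‖ ^ (N : ℝ) := by
  simp_rw [sub_div]
  exact integral_sub (integrable_fracH_div hf) (integrable_fracH_div hh)

theorem setIntegral_integral_fracH_sub {T : ℝ} {u v : ℝ → RN N → ℝ} (hu : MemLpW0 univ s p T u)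
    (hv : MemLpW0 univ s p T v) :
    ∫ t in Ioo 0 T, ∫ z : RN N × RN N,
        (fracH s p z.1 z.2 (v t z.1 - v t z.2) - fracH s p z.1 z.2 (u t z.1 - u t z.2)) /
          ‖z.1 - z.2‖ ^ (N : ℝ) =
      (∫ t in Ioo 0 T, ∫ z : RN N × RN N,
        fracH s p z.1 z.2 (v t z.1 - v t z.2) / ‖z.1 - z.2‖ ^ (N : ℝ)) -
      ∫ t in Ioo 0 T, ∫ z : RN N × RN N,
        fracH s p z.1 z.2 (u t z.1 - u t z.2) / ‖z.1 - z.2‖ ^ (N : ℝ) := by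
  rw [← integral_sub hv.integrable_integral_fracH hu.integrable_integral_fracH]
  refine integral_congr_ae ?_
  filter_upwards [hu.mem, hv.mem] with t h1 h2
  exact integral_fracH_sub_div h2 h1

/-- Convexity of the energy: its increment dominates the first variation. -/
theorem integral_powDeriv_mul_sub_le {f h : RN N → ℝ} (hf : MemW0 univ s p f)
    (hh : MemW0 univ s p h) :
    ∫ z, powDeriv p (diffQuot s p f z) * diffQuot s p (h - f) z ≤
      (∫ z : RN N × RN N, fracH s p z.1 z.2 (h z.1 - h z.2) / ‖z.1 - z.2‖ ^ (N : ℝ)) -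
        ∫ z : RN N × RN N, fracH s p z.1 z.2 (f z.1 - f z.2) / ‖z.1 - z.2‖ ^ (N : ℝ) := by
  have hp : 1 < p := Fact.out
  rw [← integral_sub (integrable_fracH_div hh) (integrable_fracH_div hf)]
  refine integral_mono (integrable_powDeriv_mul hp hf.memLp_diffQuot (hh.sub hf).memLp_diffQuot)
    ((integrable_fracH_div hh).sub (integrable_fracH_div hf)) fun z => ?_
  simp only [fracH_div_eq hp, diffQuot_sub, Pi.sub_apply]
  exact powDeriv_mul_sub_le hp _ _

theorem norm_toL2_sq {X : Type*} [MeasurableSpace X] {μ : Measure X} {f : X → ℝ}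
    (hf : MemLp f 2 μ) : ‖toL2 μ f‖ ^ 2 = ∫ x, f x ^ 2 ∂μ := by
  rw [← real_inner_self_eq_norm_sq, inner_toL2 hf hf]
  simp_rw [sq]

/-- The variational inequality on a fixed time interval. -/
theorem variational_inequality {T : ℝ} (hT : 0 < T) {u₀ : RN N → ℝ} {u v w : ℝ → RN N → ℝ}
    {g : ℝ → StrongDual ℝ (W0 Ω s p)} (hdense : TestFunDense Ω s p)
    (hΩb : Bornology.IsBounded Ω) (huW : MemLpW0 univ s p T u) (hu : MemCL2 Ω T u)
    (huW0 : MemLpW0 Ω s p T (fun t x => u t x - u₀ x)) (hug : HasDualTimeDeriv Ω s p T u g)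
    (hweak : ∀ φ : ℝ → RN N → ℝ, IsSpaceTimeTestFun Ω T φ →
      (∫ t in Ioo 0 T, ∫ z : RN N × RN N,
          deriv (fracH s p z.1 z.2) (u t z.1 - u t z.2) * (φ t z.1 - φ t z.2)
            / ‖z.1 - z.2‖ ^ (N : ℝ))
        + ∫ t in Ioo 0 T, g t (toW0 Ω s p (φ t)) = 0)
    (hv : IsComparison Ω s p u₀ T v w) :
    (1 / 2) * (∫ x in Ω, (v T x - u T x) ^ 2) - (1 / 2) * ∫ x in Ω, (v 0 x - u 0 x) ^ 2 ≤
      (∫ t in Ioo 0 T, ∫ x in Ω, w t x * (v t x - u t x))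
        + (∫ t in Ioo 0 T, ∫ z : RN N × RN N,
            (fracH s p z.1 z.2 (v t z.1 - v t z.2) - fracH s p z.1 z.2 (u t z.1 - u t z.2))
              / ‖z.1 - z.2‖ ^ (N : ℝ)) := by
  have hp : 1 < p := Fact.out
  have hpq : p.HolderConjugate (p / (p - 1)) := Real.HolderConjugate.conjExponent hp
  have hq1 : Fact (1 ≤ ENNReal.ofReal (p / (p - 1))) :=
    ⟨ENNReal.one_le_ofReal.mpr hpq.symm.lt.le⟩
  have hqp := hpq.symm.ennrealOfReal
  have hg : Integrable g (volume.restrict (Ioo 0 T)) := hug.memLp.integrable Fact.out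
  obtain ⟨hw1, hw2⟩ := memLp_toL2_slice hv.deriv.memLp
  have hz2 : ∀ t ∈ Icc 0 T, MemLp (v t - u t) 2 (volume.restrict Ω) := fun t ht =>
    (hv.memCL2.mem t ht).sub (hu.mem t ht)
  have hL : ∀ t ∈ Icc 0 T, toL2 (volume.restrict Ω) (v t) - toL2 (volume.restrict Ω) (u t) =
      toL2 (volume.restrict Ω) (v t - u t) := fun t ht =>
    (toL2_sub (hv.memCL2.mem t ht) (hu.mem t ht)).symm
  -- The common datum `u₀` cancels, so the difference vanishes outside `Ω` and is admissible in the
  -- weak equation.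
  have hzW : ∀ᵐ t ∂(volume.restrict (Ioo 0 T)), MemW0 Ω s p (v t - u t) ∧
      toW0 Ω s p (fun x => v t x - u₀ x) - toW0 Ω s p (fun x => u t x - u₀ x) =
        toW0 Ω s p (v t - u t) := by
    filter_upwards [huW0.mem, hv.memW0.mem] with t h1 h2
    have e : (fun x => v t x - u₀ x) - (fun x => u t x - u₀ x) = v t - u t := by
      funext x; simp
    rw [← toW0_sub h2 h1, e]
    exact ⟨e ▸ h2.sub h1, rfl⟩
  have hZ : MemLp (fun t => toW0 Ω s p (v t - u t)) (ENNReal.ofReal p)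
      (volume.restrict (Ioo 0 T)) :=
    (memLp_congr_ae (hzW.mono fun t ht => ht.2)).mp (hv.memW0.memLp.sub huW0.memLp)
  -- The identity of the dual, read as a bilinear map, is the duality pairing. At almost every `t`
  -- the increments are tested with `v t - u t` itself, which lies in `W^{s,p}_0(Ω) ∩ L^2(Ω)`.
  have energy := energy_inequality hT
    (ContinuousLinearMap.id ℝ (StrongDual ℝ (W0 Ω s p)))
    (L := fun t => toL2 (volume.restrict Ω) (v t) - toL2 (volume.restrict Ω) (u t))
    (hv.memCL2.continuousOn.sub hu.continuousOn) hw2 hZ hug.memLp (by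
      filter_upwards [hzW, ae_restrict_mem measurableSet_Ioo] with t ht htT t₁ ht₁
      have htc := Ioo_subset_Icc_self htT
      rw [hL t htc, ← hL t htc]
      have := inner_sub_eq_integral hT hdense hΩb hu hv.memCL2 hug hv.deriv hg ht.1 (hz2 t htc)
        ⟨ht₁.1, ht₁.2.trans htc.2⟩ htc
      rw [← hL t htc] at this
      exact this)
  simp only [ContinuousLinearMap.id_apply] at energy
  rw [hL T (right_mem_Icc.mpr hT.le), hL 0 (left_mem_Icc.mpr hT.le),
    norm_toL2_sq (hz2 T (right_mem_Icc.mpr hT.le)),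
    norm_toL2_sq (hz2 0 (left_mem_Icc.mpr hT.le))] at energy
  simp only [Pi.sub_apply] at energy
  have e1 : ∫ t in Ioo 0 T, inner ℝ (toL2 (volume.restrict Ω) fun x => w t x)
      (toL2 (volume.restrict Ω) (v t) - toL2 (volume.restrict Ω) (u t)) =
      ∫ t in Ioo 0 T, ∫ x in Ω, w t x * (v t x - u t x) := by
    refine integral_congr_ae ?_
    filter_upwards [hw1, ae_restrict_mem measurableSet_Ioo] with t ht htT
    have htc := Ioo_subset_Icc_self htT
    rw [hL t htc, inner_toL2 ht (hz2 t htc)]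
    rfl
  rw [e1] at energy
  -- At almost every time the weak equation turns the negative pairing into the first variation at
  -- `u t` in the direction `v t - u t`, which convexity bounds by the energy difference.
  have e2 : -∫ t in Ioo 0 T, g t (toW0 Ω s p (v t - u t)) ≤
      ∫ t in Ioo 0 T, ∫ z : RN N × RN N,
        (fracH s p z.1 z.2 (v t z.1 - v t z.2) - fracH s p z.1 z.2 (u t z.1 - u t z.2)) /
          ‖z.1 - z.2‖ ^ (N : ℝ) := by
    rw [setIntegral_integral_fracH_sub huW hv.memW, ← integral_neg,
      ← integral_sub hv.memW.integrable_integral_fracH huW.integrable_integral_fracH]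
    refine integral_mono_ae ?_
      (hv.memW.integrable_integral_fracH.sub huW.integrable_integral_fracH) ?_
    · exact (memLp_one_iff_integrable.mp ((ContinuousLinearMap.id ℝ
        (StrongDual ℝ (W0 Ω s p))).memLp_of_bilin 1 hug.memLp hZ)).neg
    · filter_upwards [ae_weak_formulation hdense huW hg hweak, hzW, huW.mem, hv.memW.mem]
        with t h1 h2 h3 h4
      have := integral_powDeriv_mul_sub_le h3 h4
      have := h1 _ h2.1
      linarith
  linarith

end VariationalInequality

end

/-- Weak solutions are variational solutions. The energy inequality is obtained in
`W^{s,p}_0(Ω) ∩ L^2(Ω)`, where test functions are dense by smooth truncation, so neither the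
Sobolev embedding nor `∂_t u ∈ L^2` from `hcase` is needed. -/
theorem mainTheorem5 (N : ℕ) (hN : 0 < N) (s p : ℝ) (hs0 : 0 < s) (hs1 : s < 1) [Fact (1 < p)]
    (Ω : Set (RN N)) (hΩ : IsOpen Ω) (hΩb : Bornology.IsBounded Ω)
    (hdense : TestFunDense Ω s p)
    (u₀ : RN N → ℝ) (hu₀ : MemW0 univ s p u₀) (hu₀2 : MemLp u₀ 2 (volume.restrict Ω))
    (Tmax : EReal) (hT : 0 < Tmax) (u : ℝ → RN N → ℝ)
    (hu : IsWeakSolution Ω s p u₀ Tmax u)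
    (hcase : p > 2 * (N : ℝ) / (2 * s + N) ∨
      ∀ T : ℝ, 0 < T → (T : EReal) ≤ Tmax → ∃ w : ℝ → RN N → ℝ, HasL2TimeDeriv Ω T u w) :
    IsVariationalSolution Ω s p u₀ Tmax u ∧
      (u 0 =ᵐ[volume.restrict Ω] u₀ → IsVariationalSolutionWithDatum Ω s p u₀ Tmax u) := by
  constructor
  · intro T hT0 hTm
    obtain ⟨h1, h2, h3, g, hg, hweak⟩ := hu T hT0 hTm
    exact ⟨h1, h2, h3, fun v w hv =>
      variational_inequality hT0 hdense hΩb h1 h2 h3 hg (hweak T hT0 le_rfl) hv⟩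
  · intro hinit T hT0 hTm
    obtain ⟨h1, h2, h3, g, hg, hweak⟩ := hu T hT0 hTm
    refine ⟨h1, h2, h3, fun v w hv => ?_⟩
    have hi := variational_inequality hT0 hdense hΩb h1 h2 h3 hg (hweak T hT0 le_rfl) hv
    have e : ∫ x in Ω, (v 0 x - u 0 x) ^ 2 = ∫ x in Ω, (v 0 x - u₀ x) ^ 2 := by
      refine integral_congr_ae ?_
      filter_upwards [hinit] with x hx
      rw [hx]
    -- Both energies are integrable in time, so the integral of the difference splits and the term
    -- in `u` can change sides.
    rw [e, setIntegral_integral_fracH_sub h1 hv.memW] at hi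
    linarith
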